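/- Conventions. For $f\in L^2(\mathbb R)$ let $\widehat f=\mathcal F f$ be the $L^2$-extension of $\widehat f(\xi)=\int_{\mathbb R}f(t)e^{-i\xi t}\,dt$. The Hardy space $H^2(\mathbb C^+)$ is identified (through boundary values) with the set of $f\in L^2(\mathbb R)$ such that $\widehat f(\xi)=0$ for almost all $\xi<0$, with inner product $\langle f,g\rangle=\int_{\mathbb R}f\overline g$. For $z=x+is\in\mathbb C^+$ put $\pi(z)\psi(t)=s^{-1/2}\psi(s^{-1}(t-x))$, and for $\psi,f\in H^2(\mathbb C^+)$ let $$W_\psi f(z)=\langle f,\pi(z)\psi\rangle,\qquad C_\psi=\int_0^\infty|\widehat\psi(t)|^2\,\frac{dt}{t},\qquad K_\psi(z,w)=\frac1{C_\psi}\langle\pi(w)\psi,\pi(z)\psi\rangle .$$ For $\alpha>0$ and $n\in\mathbb N_0$ let $\psi_n^\alpha\in H^2(\mathbb C^+)$ be given by $$\widehat{\psi_n^\alpha}(t)=\sqrt{\frac{2^{\alpha+2}\pi\, n!}{\Gamma(n+\alpha+1)}}\;t^{\alpha/2}e^{-t}L_n^\alpha(2t)\quad(t>0),\qquad L_n^\alpha(t)=\sum_{k=0}^n\frac{(-1)^k}{k!}\binom{n+\alpha}{n-k}t^k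 .$$ The Jacobi polynomials are $$P_n^{(\alpha,\beta)}(t)=\frac{\Gamma(n+\alpha+1)}{n!\,\Gamma(n+\alpha+\beta+1)}\sum_{k=0}^n\binom nk\frac{\Gamma(n+k+\alpha+\beta+1)}{\Gamma(k+\alpha+1)}\Big(\frac{t-1}2\Big)^k,$$ and $$Z_{n,m}^\alpha(t)=\sqrt{\frac{\Gamma(\max(n,m)+\alpha+1)\,\min(n,m)!}{\Gamma(\min(n,m)+\alpha+1)\,\max(n,m)!}}\;(-t)^{-\min(n,m)}P_{\min(n,m)}^{(|n-m|,\alpha)}(1-2t).$$ Complex powers are taken with the principal branch. Proposition. Let $\alpha>0$. (1) For every $n\in\mathbb N_0$, $C_{\psi_n^\alpha}=4\pi/\alpha$. (2) For every $n\in\mathbb N_0$ and all $z=x+is$, $w=x'+is'$ in $\mathbb C^+$, $$K_{\psi_n^\alpha}(z,w)=\frac{\alpha}{4\pi}\left(\frac{w-\overline z}{z-\overline w}\right)^n\left(\frac{2\sqrt{ss'}}{i(\overline w-z)}\right)^{\alpha+1}P_n^{(0,\alpha)}\left(1-2\left|\frac{z-w}{z-\overline w}\right|^2\right).$$ (3)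 For all $n,m\in\mathbb N_0$ and $z=x+is\in\mathbb C^+$, $$W_{\psi_n^\alpha}\psi_m^\alpha(z)=\left(\frac{z-i}{z+i}\right)^m\left(\frac{\overline z+i}{z+i}\right)^n\left(\frac{2\sqrt s}{1-iz}\right)^{\alpha+1}Z_{n,m}^\alpha\left(\left|\frac{z-i}{z+i}\right|^2\right),$$ where at $z=i$, if $\min(n,m)\ge1$, the right-hand side (which has the form $0\cdot\infty$ there) is understood as its limit for $z\to i$, $z\ne i$; this limit exists. -/

import Mathlib

open MeasureTheory Filter Topology
open scoped FourierTransform ENNReal ComplexConjugate UpperHalfPlane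

noncomputable section

namespace AnalyticWavelet

/-- The complex Hilbert space `L²(ℝ)`. -/
abbrev L2R : Type := Lp (α := ℝ) ℂ 2

/-- The `L²` Fourier transform in the normalization `f̂(ξ) = ∫ f(t) e^{-iξt} dt`.
Mathlib's `𝓕` uses the phase `e^{-2πiξt}`, hence the rescaling of the frequency. -/
def fourier (f : L2R) : ℝ → ℂ := fun ξ => (𝓕 f : L2R) (ξ / (2 * Real.pi))

lemma memLp_comp_affine {f : ℝ → ℂ} (hf : MemLp f 2 volume) (x s : ℝ) (hs : s ≠ 0) :
    MemLp (fun t => f (s⁻¹ * (t - x))) 2 volume := by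
  have hq : Measure.QuasiMeasurePreserving (fun t : ℝ => s⁻¹ * (t - x)) volume volume := by
    have h1 : Measure.QuasiMeasurePreserving (fun t : ℝ => s⁻¹ * t) volume volume := by
      refine ⟨by fun_prop, ?_⟩
      rw [Real.map_volume_mul_left (inv_ne_zero hs)]
      exact Measure.smul_absolutelyContinuous
    exact h1.comp (measurePreserving_sub_right volume x).quasiMeasurePreserving
  have hm : AEStronglyMeasurable (fun t => f (s⁻¹ * (t - x))) volume :=
    hf.aestronglyMeasurable.comp_quasiMeasurePreserving hq
  rw [memLp_two_iff_integrable_sq_norm hm]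
  have h := (memLp_two_iff_integrable_sq_norm hf.aestronglyMeasurable).1 hf
  exact (h.comp_mul_left' (inv_ne_zero hs)).comp_sub_right x

/-- The Hardy space `H²(ℂ⁺)`, as the space of (boundary values) `f ∈ L²(ℝ)` whose Fourier transform
vanishes almost everywhere on the negative half line. -/
def hardySpace : Submodule ℂ L2R where
  carrier := {f | ∀ᵐ ξ : ℝ, ξ < 0 → (𝓕 f : L2R) ξ = 0}
  zero_mem' := by
    have h : (𝓕 (0 : L2R) : L2R) = 0 := map_zero (Lp.fourierTransformₗᵢ ℝ ℂ)
    simp only [Set.mem_ofPred_eq, h]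
    filter_upwards [Lp.coeFn_zero ℂ 2 (volume : Measure ℝ)] with ξ hξ _
    simp
  add_mem' := by
    intro f g hf hg
    have h : (𝓕 (f + g) : L2R) = 𝓕 f + 𝓕 g := map_add (Lp.fourierTransformₗᵢ ℝ ℂ) f g
    simp only [Set.mem_ofPred_eq, h] at hf hg ⊢
    filter_upwards [hf, hg, Lp.coeFn_add (𝓕 f : L2R) (𝓕 g)] with ξ h1 h2 h3 hξ
    rw [h3, Pi.add_apply, h1 hξ, h2 hξ, add_zero]
  smul_mem' := by
    intro c f hf
    have h : (𝓕 (c • f) : L2R) = c • 𝓕 f := map_smul (Lp.fourierTransformₗᵢ ℝ ℂ) c f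
    simp only [Set.mem_ofPred_eq, h] at hf ⊢
    filter_upwards [hf, Lp.coeFn_smul c (𝓕 f : L2R)] with ξ h1 h2 hξ
    rw [h2, Pi.smul_apply, h1 hξ, smul_zero]

/-- The representation of the affine group, identified with the upper half plane by
`(x, s) ↔ x + is`: `π(z)ψ(t) = s^{-1/2} ψ((t - x)/s)` for `z = x + is`. -/
def affineRep (z : ℍ) (ψ : L2R) : L2R :=
  (((memLp_comp_affine (Lp.memLp ψ) z.re z.im z.im_pos.ne').const_mul
    (((Real.sqrt z.im)⁻¹ : ℝ) : ℂ))).toLp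
      (fun t => (((Real.sqrt z.im)⁻¹ : ℝ) : ℂ) * ψ (z.im⁻¹ * (t - z.re)))

/-- The continuous wavelet transform `W_ψ f(z) = ⟨f, π(z)ψ⟩`, the inner product being linear in the
first argument (Mathlib's is linear in the second one). -/
def waveletTransform (ψ f : hardySpace) (z : ℍ) : ℂ :=
  inner ℂ (affineRep z (ψ : L2R)) (f : L2R)

/-- The admissibility constant `C_ψ = ∫₀^∞ |ψ̂(t)|² dt/t ∈ [0, ∞]`. -/
def admissibilityConst (ψ : hardySpace) : ℝ≥0∞ :=
  ∫⁻ t in Set.Ioi (0 : ℝ), ‖fourier (ψ : L2R) t‖ₑ ^ 2 / ENNReal.ofReal t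

/-- The reproducing kernel `K_ψ(z, w) = C_ψ⁻¹ ⟨π(w)ψ, π(z)ψ⟩`, linear in the first argument of the
inner product. -/
def reproducingKernel (ψ : hardySpace) (z w : ℍ) : ℂ :=
  (((admissibilityConst ψ).toReal)⁻¹ : ℝ) *
    inner ℂ (affineRep z (ψ : L2R)) (affineRep w (ψ : L2R))

/-- The generalized Laguerre polynomial `L_n^α`. -/
def laguerre (n : ℕ) (α t : ℝ) : ℝ :=
  ∑ k ∈ Finset.range (n + 1),
    (-1) ^ k / (k.factorial : ℝ) * Ring.choose ((n : ℝ) + α) (n - k) * t ^ k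

/-- The Jacobi polynomial `P_n^{(α, β)}`. -/
def jacobi (n : ℕ) (α β t : ℝ) : ℝ :=
  Real.Gamma (n + α + 1) / (n.factorial * Real.Gamma (n + α + β + 1)) *
    ∑ k ∈ Finset.range (n + 1),
      (n.choose k : ℝ) * (Real.Gamma (n + k + α + β + 1) / Real.Gamma (k + α + 1)) *
        ((t - 1) / 2) ^ k

/-- The Zernike-type functions `Z_{n,m}^α`. -/
def zernike (n m : ℕ) (α t : ℝ) : ℝ :=
  Real.sqrt (Real.Gamma ((max n m : ℕ) + α + 1) * (min n m).factorial /
      (Real.Gamma ((min n m : ℕ) + α + 1) * (max n m).factorial)) *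
    (-t) ^ (-((min n m : ℕ) : ℤ)) *
    jacobi (min n m) |(n : ℝ) - (m : ℝ)| α (1 - 2 * t)

/-- The Fourier transform of `ψ_n^α`; it vanishes on `(-∞, 0]`. -/
def psiHat (α : ℝ) (n : ℕ) (t : ℝ) : ℂ :=
  Set.indicator (Set.Ioi (0 : ℝ)) (fun t : ℝ =>
    ((Real.sqrt ((2 : ℝ) ^ (α + 2) * Real.pi * n.factorial / Real.Gamma (n + α + 1)) *
      t ^ (α / 2) * Real.exp (-t) * laguerre n α (2 * t) : ℝ) : ℂ)) t

lemma memLp_rpow_exp (a : ℝ) (ha : 0 ≤ a) :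
    MemLp (Set.indicator (Set.Ioi (0 : ℝ)) (fun t : ℝ => ((t ^ a * Real.exp (-t) : ℝ) : ℂ)))
      2 volume := by
  have hmeas : Measurable (fun t : ℝ => ((t ^ a * Real.exp (-t) : ℝ) : ℂ)) := by fun_prop
  rw [memLp_indicator_iff_restrict measurableSet_Ioi,
    memLp_two_iff_integrable_sq_norm hmeas.aestronglyMeasurable]
  have h := integrableOn_rpow_mul_exp_neg_mul_rpow (s := 2 * a) (p := 1) (b := 2)
    (by linarith) one_pos (by norm_num)
  refine IntegrableOn.congr_fun h ?_ measurableSet_Ioi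
  intro t ht
  have ht' : (0 : ℝ) < t := ht
  simp only [Real.rpow_one, Complex.norm_real, Real.norm_eq_abs, sq_abs]
  rw [mul_pow, ← Real.exp_nat_mul, ← Real.rpow_natCast (t ^ a) 2, ← Real.rpow_mul ht'.le]
  push_cast
  ring_nf

lemma memLp_psiHat (α : ℝ) (hα : 0 < α) (n : ℕ) : MemLp (psiHat α n) 2 volume := by
  have h := memLp_finsetSum (μ := (volume : Measure ℝ)) (p := 2) (Finset.range (n + 1))
    (f := fun k (t : ℝ) =>
      ((Real.sqrt ((2 : ℝ) ^ (α + 2) * Real.pi * n.factorial / Real.Gamma (n + α + 1)) *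
        ((-1) ^ k / (k.factorial : ℝ) * Ring.choose ((n : ℝ) + α) (n - k) * 2 ^ k) : ℝ) : ℂ) *
      Set.indicator (Set.Ioi (0 : ℝ))
        (fun t : ℝ => ((t ^ (α / 2 + k) * Real.exp (-t) : ℝ) : ℂ)) t)
    (fun k _ => (memLp_rpow_exp (α / 2 + k) (by positivity)).const_mul _)
  convert h using 1
  funext t
  unfold psiHat
  by_cases ht : t ∈ Set.Ioi (0 : ℝ)
  · have ht' : (0 : ℝ) < t := ht
    simp only [Set.indicator_of_mem ht]
    rw [laguerre, Finset.mul_sum, Complex.ofReal_sum]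
    refine Finset.sum_congr rfl fun k _ => ?_
    rw [← Complex.ofReal_mul, Real.rpow_add ht', Real.rpow_natCast, mul_pow]
    congr 1
    ring
  · simp [Set.indicator_of_notMem ht]

/-- `η ↦ ψ̂_n^α(2πη)`, the Fourier transform of `ψ_n^α` in Mathlib's normalization. -/
def psiHatL2 (α : ℝ) (hα : 0 < α) (n : ℕ) : L2R :=
  (memLp_comp_affine (memLp_psiHat α hα n) 0 (2 * Real.pi)⁻¹
    (inv_ne_zero Real.two_pi_pos.ne')).toLp
      (fun η => psiHat α n (((2 * Real.pi)⁻¹)⁻¹ * (η - 0)))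

lemma psiHatL2_ae (α : ℝ) (hα : 0 < α) (n : ℕ) :
    ∀ᵐ η : ℝ, psiHatL2 α hα n η = psiHat α n (2 * Real.pi * η) := by
  filter_upwards [MemLp.coeFn_toLp (memLp_comp_affine (memLp_psiHat α hα n) 0 (2 * Real.pi)⁻¹
    (inv_ne_zero Real.two_pi_pos.ne'))] with η hη
  rw [psiHatL2, hη, inv_inv, sub_zero]

/-- The wavelet `ψ_n^α ∈ H²(ℂ⁺)`, defined by its Fourier transform. -/
def psi (α : ℝ) (hα : 0 < α) (n : ℕ) : hardySpace :=
  ⟨𝓕⁻ (psiHatL2 α hα n), by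
    change ∀ᵐ ξ : ℝ, ξ < 0 → (𝓕 (𝓕⁻ (psiHatL2 α hα n)) : L2R) ξ = 0
    rw [FourierTransform.fourier_fourierInv_eq]
    filter_upwards [psiHatL2_ae α hα n] with ξ h hξ
    rw [h, psiHat, Set.indicator_of_notMem]
    have := mul_neg_of_pos_of_neg Real.two_pi_pos hξ
    exact fun hc => absurd hc (not_lt.2 this.le)⟩

/-- The Fourier transform of `ψ_n^α` is the prescribed function. -/
lemma fourier_psi (α : ℝ) (hα : 0 < α) (n : ℕ) :
    fourier (psi α hα n : L2R) =ᵐ[volume] psiHat α n := by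
  have hq : Measure.QuasiMeasurePreserving (fun t : ℝ => t / (2 * Real.pi)) volume volume := by
    refine ⟨by fun_prop, ?_⟩
    simp only [div_eq_mul_inv]
    rw [Real.map_volume_mul_right (inv_ne_zero Real.two_pi_pos.ne')]
    exact Measure.smul_absolutelyContinuous
  filter_upwards [hq.ae (psiHatL2_ae α hα n)] with ξ hξ
  have h : (𝓕 (psi α hα n : L2R) : L2R) = psiHatL2 α hα n :=
    FourierTransform.fourier_fourierInv_eq (psiHatL2 α hα n)
  rw [fourier, h, hξ, mul_div_cancel₀ _ Real.two_pi_pos.ne']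

/-- The closed form of `W_{ψ_n^α} ψ_m^α`. -/
def waveletFormula (α : ℝ) (n m : ℕ) (z : ℍ) : ℂ :=
  (((z : ℂ) - Complex.I) / (z + Complex.I)) ^ m *
    ((conj (z : ℂ) + Complex.I) / (z + Complex.I)) ^ n *
    (2 * (Real.sqrt z.im : ℂ) / (1 - Complex.I * z)) ^ ((α : ℂ) + 1) *
    (zernike n m α (‖((z : ℂ) - Complex.I) / (z + Complex.I)‖ ^ 2) : ℂ)

end AnalyticWavelet

end

namespace AnalyticWavelet

/-! Everything follows from one closed form for `⟨π(w)ψ_m, π(z)ψ_n⟩` (`inner_affineRep_psi`). On the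
Fourier side `π(z)` is a dilation times a phase, so Plancherel turns this inner product into the
integral over `ξ > 0` of `e^{i(x-x')ξ} ψ̂_n(sξ) ψ̂_m(s'ξ)`. Expanding both Laguerre polynomials
gives Gamma integrals with rate `p = s + s' - i(x - x') = i(w̄ - z)`. What remains is `p^{-(α+1)}`
times a finite double sum in `u = 2s'/p` and `v = 2s/p`, whose indices are coupled only through
`Γ(α+j+k+1)`.

Chu–Vandermonde (`gamma_vandermonde`) decouples the indices, and the binomial theorem then gives a
single sum of terms `(uv)^i (1-u)^{m-i} (1-v)^{n-i}`. Substituting `uv = (u+v-1) + (1-u)(1-v)`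
re-expands it in the three quantities `1-u`, `1-v`, `u+v-1` (`double_sum_eq`), which are
`(z-w)/(z-w̄)`, `(z̄-w̄)/(z-w̄)` and `(w-z̄)/(z-w̄)`. The first two multiply to `-|(z-w)/(z-w̄)|²`
times the third, and this turns the sum into a Jacobi polynomial read in reverse order.

The kernel is the case `n = m`; the wavelet transform is the case `w = i`, where `π(i)` is the
identity. The closed form has no negative powers, so it is continuous at `z = i` and supplies the
limit there.

The admissibility constant uses the same expansion with an extra `1/t`, which lowers the Gamma
argument by one. All terms with `k ≥ 1` then vanish as `n`-th differences of polynomials of degree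
`< n`, and `k = 0` leaves a Beta value. -/

/-! ### Laguerre coefficients as Gamma quotients. -/

lemma ringChoose_eq_gamma {α : ℝ} (hα : 0 < α) {n k : ℕ} (hk : k ≤ n) :
    Ring.choose ((n : ℝ) + α) (n - k) =
      Real.Gamma (n + α + 1) / ((n - k).factorial * Real.Gamma (k + α + 1)) := by
  have key : ∀ (r : ℕ) (y : ℝ), 0 < y →
      Real.Gamma (y + r) = (ascPochhammer ℝ r).eval y * Real.Gamma y := by
    intro r y hy
    induction r with
    | zero => simp
    | succ r ih =>
      rw [ascPochhammer_succ_eval, Nat.cast_succ, ← add_assoc,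
        Real.Gamma_add_one (by positivity), ih]
      ring
  have h1 := Ring.factorial_nsmul_multichoose_eq_ascPochhammer ((k : ℝ) + α + 1) (n - k)
  rw [Polynomial.ascPochhammer_smeval_eq_eval, nsmul_eq_mul] at h1
  have h2 := key (n - k) (k + α + 1) (by positivity)
  have h3 : (k : ℝ) + α + 1 + (n - k : ℕ) = n + α + 1 := by
    rw [Nat.cast_sub hk]; ring
  have h4 : Ring.choose ((n : ℝ) + α) (n - k) = Ring.multichoose ((k : ℝ) + α + 1) (n - k) := by
    rw [Ring.multichoose_eq]
    congr 1
    rw [Nat.cast_sub hk]; ring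
  have h5 : Real.Gamma (k + α + 1) ≠ 0 := (Real.Gamma_pos_of_pos (by positivity)).ne'
  have h6 : ((n - k).factorial : ℝ) ≠ 0 := by positivity
  rw [h4, eq_div_iff (by positivity), ← h3, h2, ← h1]
  ring

lemma laguerre_eq {α : ℝ} (hα : 0 < α) (n : ℕ) (t : ℝ) :
    laguerre n α t = Real.Gamma (n + α + 1) / n.factorial *
      ∑ k ∈ Finset.range (n + 1), (n.choose k : ℝ) / Real.Gamma (α + k + 1) * (-t) ^ k := by
  rw [laguerre, Finset.mul_sum]
  refine Finset.sum_congr rfl fun k hk => ?_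
  have hk' : k ≤ n := Nat.lt_succ_iff.1 (Finset.mem_range.1 hk)
  rw [ringChoose_eq_gamma hα hk', Nat.cast_choose ℝ hk', neg_pow t, add_comm α (k : ℝ)]
  have h5 : Real.Gamma (k + α + 1) ≠ 0 := (Real.Gamma_pos_of_pos (by positivity)).ne'
  field_simp

/-! ### Chu–Vandermonde and finite binomial sums. -/

/-- Induction on `j` by Pascal's rule. The shifted half of the sum is the same identity at `α + 1`
and `k - 1`, since `k` descending `i + 1` times is `k` times `k - 1` descending `i` times; hence `α`
and `k` both vary in the induction. -/
lemma gamma_vandermonde_range {α : ℝ} (hα : 0 ≤ α) (j k : ℕ) :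
    ∑ i ∈ Finset.range (j + 1), (j.choose i : ℝ) * k.descFactorial i / Real.Gamma (α + i + 1) =
      Real.Gamma (α + j + k + 1) / (Real.Gamma (α + j + 1) * Real.Gamma (α + k + 1)) := by
  induction j generalizing k α with
  | zero =>
    have h1 : Real.Gamma (α + 1) ≠ 0 := (Real.Gamma_pos_of_pos (by positivity)).ne'
    have h2 : Real.Gamma (α + k + 1) ≠ 0 := (Real.Gamma_pos_of_pos (by positivity)).ne'
    simp
    field_simp
  | succ j ih =>
    have h1 : Real.Gamma (α + j + 1) ≠ 0 := (Real.Gamma_pos_of_pos (by positivity)).ne'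
    have h2 : Real.Gamma (α + k + 1) ≠ 0 := (Real.Gamma_pos_of_pos (by positivity)).ne'
    have hsplit : ∑ i ∈ Finset.range (j + 1 + 1),
        ((j + 1).choose i : ℝ) * k.descFactorial i / Real.Gamma (α + i + 1) =
        (∑ i ∈ Finset.range (j + 1),
          (j.choose i : ℝ) * k.descFactorial i / Real.Gamma (α + i + 1)) +
        k * ∑ i ∈ Finset.range (j + 1),
          (j.choose i : ℝ) * (k - 1).descFactorial i / Real.Gamma (α + 1 + i + 1) := by
      have hlast : ∑ i ∈ Finset.range (j + 1),
          (j.choose i : ℝ) * k.descFactorial i / Real.Gamma (α + i + 1) =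
          ∑ i ∈ Finset.range (j + 1 + 1),
          (j.choose i : ℝ) * k.descFactorial i / Real.Gamma (α + i + 1) := by
        rw [Finset.sum_range_succ _ (j + 1)]
        simp
      rw [hlast, Finset.sum_range_succ' _ (j + 1), Finset.sum_range_succ' _ (j + 1),
        Finset.mul_sum]
      conv_rhs => rw [add_right_comm, ← Finset.sum_add_distrib]
      congr 1
      · refine Finset.sum_congr rfl fun i _ => ?_
        have hd : (k.descFactorial (i + 1) : ℝ) = k * (k - 1).descFactorial i := by
          cases k with
          | zero => simp
          | succ k => rw [Nat.succ_descFactorial_succ]; push_cast; simp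
        rw [Nat.choose_succ_succ', hd]
        push_cast
        rw [show α + 1 + (i : ℝ) + 1 = α + (i + 1) + 1 by ring]
        ring
      · simp
    rw [hsplit, ih hα k]
    have h3 : Real.Gamma (α + (j + 1 : ℕ) + 1) = (α + j + 1) * Real.Gamma (α + j + 1) := by
      rw [← Real.Gamma_add_one (by positivity)]; push_cast; ring_nf
    have h4 : Real.Gamma (α + (j + 1 : ℕ) + k + 1) =
        (α + j + k + 1) * Real.Gamma (α + j + k + 1) := by
      rw [← Real.Gamma_add_one (by positivity)]; push_cast; ring_nf
    rw [h3, h4]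
    have hj : α + (j : ℝ) + 1 ≠ 0 := by positivity
    -- At `k = 0` the truncated `k - 1` is harmless because the second sum carries the factor `k`.
    cases k with
    | zero => simp; field_simp
    | succ k =>
      rw [ih (by positivity : 0 ≤ α + 1) (k + 1 - 1)]
      have h5 : Real.Gamma (α + 1 + j + 1) = (α + j + 1) * Real.Gamma (α + j + 1) := by
        rw [← Real.Gamma_add_one (by positivity)]; ring_nf
      have h6 : Real.Gamma (α + 1 + j + (k + 1 - 1 : ℕ) + 1) =
          Real.Gamma (α + j + (k + 1 : ℕ) + 1) := by
        congr 1; push_cast [Nat.add_sub_cancel]; ring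
      have h7 : Real.Gamma (α + 1 + (k + 1 - 1 : ℕ) + 1) = Real.Gamma (α + (k + 1 : ℕ) + 1) := by
        congr 1; push_cast [Nat.add_sub_cancel]; ring
      rw [h5, h6, h7]
      field_simp
      push_cast
      ring

/-- A Chu–Vandermonde identity in terms of the Gamma function. -/
lemma gamma_vandermonde {α : ℝ} (hα : 0 ≤ α) {j k N : ℕ} (hN : min j k ≤ N) :
    ∑ i ∈ Finset.range (N + 1), (j.choose i : ℝ) * k.descFactorial i / Real.Gamma (α + i + 1) =
      Real.Gamma (α + j + k + 1) / (Real.Gamma (α + j + 1) * Real.Gamma (α + k + 1)) := by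
  rw [← gamma_vandermonde_range hα j k]
  -- Terms beyond `min j k` vanish, so the upper limit is free; later one common range of `i` has to
  -- serve all pairs `(j, k)`.
  have h0 : ∀ i, min j k < i →
      (j.choose i : ℝ) * k.descFactorial i / Real.Gamma (α + i + 1) = 0 := by
    intro i hi
    rcases min_lt_iff.1 hi with h | h
    · simp [Nat.choose_eq_zero_of_lt h]
    · simp [Nat.descFactorial_eq_zero_iff_lt.2 h]
  have hsub : ∀ M, min j k ≤ M → ∑ i ∈ Finset.range (min j k + 1),
      (j.choose i : ℝ) * k.descFactorial i / Real.Gamma (α + i + 1) =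
      ∑ i ∈ Finset.range (M + 1),
      (j.choose i : ℝ) * k.descFactorial i / Real.Gamma (α + i + 1) := by
    intro M hM
    refine Finset.sum_subset (Finset.range_mono (by omega)) fun i _ hi => h0 i ?_
    rw [Finset.mem_range] at hi
    omega
  rw [← hsub N hN, ← hsub j (min_le_left _ _)]

/-- Trinomial revision `C(m,j) C(j,i) = C(m,i) C(m-i,j-i)` followed by the binomial theorem. -/
lemma sum_choose_mul_choose_mul_pow {R : Type*} [CommRing R] (m i : ℕ) (x : R) :
    ∑ j ∈ Finset.range (m + 1), (m.choose j : R) * j.choose i * x ^ j =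
      m.choose i * x ^ i * (1 + x) ^ (m - i) := by
  rcases lt_or_ge m i with h | h
  · rw [Nat.choose_eq_zero_of_lt h, Finset.sum_eq_zero]
    · simp
    · intro j hj
      rw [Nat.choose_eq_zero_of_lt (n := j) (by have := Finset.mem_range.1 hj; omega)]
      simp
  · obtain ⟨d, rfl⟩ := Nat.exists_eq_add_of_le h
    rw [Nat.add_sub_cancel_left, add_assoc, Finset.sum_range_add, Finset.sum_eq_zero, zero_add,
      add_comm (1 : R), add_pow, Finset.mul_sum]
    · refine Finset.sum_congr rfl fun r hr => ?_
      have hc := Nat.choose_mul (n := i + d) (k := i + r) (s := i) (by omega)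
      rw [Nat.add_sub_cancel_left, Nat.add_sub_cancel_left] at hc
      rw [← Nat.cast_mul, hc]
      push_cast
      ring
    · intro j hj
      rw [Nat.choose_eq_zero_of_lt (n := j) (Finset.mem_range.1 hj)]
      simp

/-- By Chu–Vandermonde the Gamma quotient is a polynomial in `j` of degree at most `k`, written in
the basis `C(j,i)`; the `n`-th difference annihilates it because `(1 + x)^(n-i)` vanishes at `x =
-1`. -/
lemma sum_neg_one_pow_mul_gamma_eq_zero {α : ℝ} (hα : 0 ≤ α) {n k : ℕ} (hk : k < n) :
    ∑ j ∈ Finset.range (n + 1), (-1 : ℝ) ^ j * n.choose j *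
      (Real.Gamma (α + j + k + 1) / (Real.Gamma (α + j + 1) * Real.Gamma (α + k + 1))) = 0 := by
  calc _ = ∑ j ∈ Finset.range (n + 1), ∑ i ∈ Finset.range (k + 1),
      (k.descFactorial i / Real.Gamma (α + i + 1)) *
        ((n.choose j : ℝ) * j.choose i * (-1) ^ j) := by
        refine Finset.sum_congr rfl fun j _ => ?_
        rw [← gamma_vandermonde hα (min_le_right j k), Finset.mul_sum]
        refine Finset.sum_congr rfl fun i _ => ?_
        ring
    _ = 0 := by
        rw [Finset.sum_comm]
        refine Finset.sum_eq_zero fun i hi => ?_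
        have hi' := Finset.mem_range.1 hi
        rw [← Finset.mul_sum, sum_choose_mul_choose_mul_pow, add_neg_cancel,
          zero_pow (by omega : n - i ≠ 0), mul_zero, mul_zero]

/-- The value is the Beta function `B(α, n+1)`. Pascal's rule writes the sum for `n + 1` as the
difference of the sums for `n` at `α` and at `α + 1`. -/
lemma sum_neg_one_pow_div {α : ℝ} (hα : 0 < α) (n : ℕ) :
    ∑ j ∈ Finset.range (n + 1), (-1 : ℝ) ^ j * n.choose j / (α + j) =
      n.factorial * Real.Gamma α / Real.Gamma (α + n + 1) := by
  induction n generalizing α with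
  | zero =>
    have h := Real.Gamma_add_one hα.ne'
    have h1 : Real.Gamma α ≠ 0 := (Real.Gamma_pos_of_pos hα).ne'
    simp [h]
    field_simp
  | succ n ih =>
    have hsplit : ∑ j ∈ Finset.range (n + 1 + 1), (-1 : ℝ) ^ j * (n + 1).choose j / (α + j) =
        (∑ j ∈ Finset.range (n + 1), (-1 : ℝ) ^ j * n.choose j / (α + j)) -
        ∑ j ∈ Finset.range (n + 1), (-1 : ℝ) ^ j * n.choose j / (α + 1 + j) := by
      have hlast : ∑ j ∈ Finset.range (n + 1), (-1 : ℝ) ^ j * n.choose j / (α + j) =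
          ∑ j ∈ Finset.range (n + 1 + 1), (-1 : ℝ) ^ j * n.choose j / (α + j) := by
        rw [Finset.sum_range_succ _ (n + 1)]
        simp
      rw [hlast, Finset.sum_range_succ' _ (n + 1), Finset.sum_range_succ' _ (n + 1)]
      conv_rhs => rw [add_sub_right_comm, ← Finset.sum_sub_distrib]
      congr 1
      · refine Finset.sum_congr rfl fun j _ => ?_
        rw [Nat.choose_succ_succ']
        push_cast
        rw [show α + 1 + (j : ℝ) = α + (j + 1) by ring]
        ring
      · simp
    have h1 : Real.Gamma (α + 1) = α * Real.Gamma α := Real.Gamma_add_one hα.ne'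
    have h2 : Real.Gamma (α + 1 + n + 1) = (α + n + 1) * Real.Gamma (α + n + 1) := by
      rw [← Real.Gamma_add_one (by positivity)]; ring_nf
    have h3 : Real.Gamma (α + (n + 1 : ℕ) + 1) = (α + n + 1) * Real.Gamma (α + n + 1) := by
      rw [← Real.Gamma_add_one (by positivity)]; push_cast; ring_nf
    have h4 : Real.Gamma (α + n + 1) ≠ 0 := (Real.Gamma_pos_of_pos (by positivity)).ne'
    have h5 : α + n + 1 ≠ 0 := by positivity
    rw [hsplit, ih hα, ih (by positivity), h1, h2, h3, Nat.factorial_succ]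
    push_cast
    field_simp
    ring

/-- Here the Gamma argument is one lower than in `gamma_vandermonde`. Each row with positive second
index is therefore an `n`-th difference of degree below `n`; only the row with index `0` survives.
-/
lemma double_sum_admissibility {α : ℝ} (hα : 0 < α) (n : ℕ) :
    ∑ j ∈ Finset.range (n + 1), ∑ k ∈ Finset.range (n + 1),
      (n.choose j : ℝ) / Real.Gamma (α + j + 1) * (n.choose k / Real.Gamma (α + k + 1)) *
        ((-1) ^ j * (-1) ^ k) * Real.Gamma (α + j + k) =
      n.factorial / (α * Real.Gamma (α + n + 1)) := by
  rw [Finset.sum_comm, Finset.sum_range_succ', Finset.sum_eq_zero, zero_add]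
  · have h1 : Real.Gamma (α + 1) = α * Real.Gamma α := Real.Gamma_add_one hα.ne'
    have h0 : Real.Gamma α ≠ 0 := (Real.Gamma_pos_of_pos hα).ne'
    have h2 : Real.Gamma (α + n + 1) ≠ 0 := (Real.Gamma_pos_of_pos (by positivity)).ne'
    calc _ = (1 / Real.Gamma (α + 1)) *
        ∑ j ∈ Finset.range (n + 1), (-1 : ℝ) ^ j * n.choose j / (α + j) := by
          rw [Finset.mul_sum]
          refine Finset.sum_congr rfl fun j _ => ?_
          have h3 : Real.Gamma (α + j + 1) = (α + j) * Real.Gamma (α + j) :=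
            Real.Gamma_add_one (by positivity)
          have h4 : Real.Gamma (α + j) ≠ 0 := (Real.Gamma_pos_of_pos (by positivity)).ne'
          have h5 : α + j ≠ 0 := by positivity
          simp only [Nat.choose_zero_right, Nat.cast_one, Nat.cast_zero, add_zero, pow_zero, mul_one,
            h3]
          field_simp
      _ = _ := by
          rw [sum_neg_one_pow_div hα, h1]
          field_simp
  · intro k hk
    have hk' : k < n := Finset.mem_range.1 hk
    have h := sum_neg_one_pow_mul_gamma_eq_zero hα.le hk'
    have h1 : Real.Gamma (α + k + 1) ≠ 0 := (Real.Gamma_pos_of_pos (by positivity)).ne'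
    calc _ = (n.choose (k + 1) / Real.Gamma (α + (k + 1 : ℕ) + 1) * (-1) ^ (k + 1) *
          Real.Gamma (α + k + 1)) * ∑ j ∈ Finset.range (n + 1), (-1 : ℝ) ^ j * n.choose j *
      (Real.Gamma (α + j + k + 1) / (Real.Gamma (α + j + 1) * Real.Gamma (α + k + 1))) := by
          rw [Finset.mul_sum]
          refine Finset.sum_congr rfl fun j _ => ?_
          rw [show α + (j : ℝ) + (k + 1 : ℕ) = α + j + k + 1 by push_cast; ring]
          field_simp
      _ = 0 := by rw [h, mul_zero]

/-- Terms with `i < l` vanish. With `i = l + r`, trinomial revision takes out `C(n,l)`, and what is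
left is Chu–Vandermonde at `α + l`, `n - l`, `m - l`. -/
lemma sum_choose_descFactorial_choose {α : ℝ} (hα : 0 ≤ α) (m n l : ℕ) (hm : l ≤ m) (hn : l ≤ n) :
    ∑ i ∈ Finset.range (min n m + 1),
      (n.choose i : ℝ) * m.descFactorial i / Real.Gamma (α + i + 1) * i.choose l =
      n.choose l * m.descFactorial l * Real.Gamma ((n : ℝ) + m - l + α + 1) /
        (Real.Gamma (α + m + 1) * Real.Gamma (α + n + 1)) := by
  obtain ⟨p, rfl⟩ := Nat.exists_eq_add_of_le hm
  obtain ⟨q, rfl⟩ := Nat.exists_eq_add_of_le hn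
  have hmin : min (l + q) (l + p) + 1 = l + (min q p + 1) := by omega
  rw [hmin, Finset.sum_range_add, Finset.sum_eq_zero, zero_add]
  · have hV := gamma_vandermonde (α := α + l) (by positivity) (le_refl (min q p))
    have e1 : α + (l : ℝ) + q + 1 = α + (l + q : ℕ) + 1 := by push_cast; ring
    have e2 : α + (l : ℝ) + p + 1 = α + (l + p : ℕ) + 1 := by push_cast; ring
    have e3 : α + (l : ℝ) + q + p + 1 = ((l + q : ℕ) : ℝ) + (l + p : ℕ) - l + α + 1 := by
      push_cast; ring
    rw [e1, e2, e3] at hV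
    rw [mul_comm (Real.Gamma (α + (l + p : ℕ) + 1)), mul_div_assoc, ← hV, Finset.mul_sum]
    refine Finset.sum_congr rfl fun r hr => ?_
    have hc := Nat.choose_mul (n := l + q) (k := l + r) (s := l) (by omega)
    rw [Nat.add_sub_cancel_left, Nat.add_sub_cancel_left] at hc
    have hd : (l + p).descFactorial (l + r) = p.descFactorial r * (l + p).descFactorial l := by
      have := Nat.descFactorial_mul_descFactorial (n := l + p) (k := l) (m := l + r) (by omega)
      rw [Nat.add_sub_cancel_left, Nat.add_sub_cancel_left] at this
      exact this.symm
    have hc' : ((l + q).choose (l + r) : ℝ) * (l + r).choose l = (l + q).choose l * q.choose r := by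
      exact_mod_cast hc
    rw [hd, show α + ((l + r : ℕ) : ℝ) + 1 = α + l + r + 1 by push_cast; ring]
    push_cast
    linear_combination (p.descFactorial r * (l + p).descFactorial l / Real.Gamma (α + l + r + 1)) *
      hc'
  · intro i hi
    rw [Nat.choose_eq_zero_of_lt (n := i) (Finset.mem_range.1 hi)]
    simp

/-- The algebraic core: a sum coupled through `Γ(α+j+k+1)` is rewritten in `1 - u`, `1 - v` and `u +
v - 1`, the quantities with geometric meaning in the half plane. -/
lemma double_sum_eq {α : ℝ} (hα : 0 ≤ α) (m n : ℕ) (u v : ℂ) :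
    ∑ j ∈ Finset.range (m + 1), ∑ k ∈ Finset.range (n + 1),
      (m.choose j : ℂ) * n.choose k *
        ((Real.Gamma (α + j + k + 1) / (Real.Gamma (α + j + 1) * Real.Gamma (α + k + 1)) : ℝ) : ℂ) *
        ((-u) ^ j * (-v) ^ k) =
    ∑ l ∈ Finset.range (min n m + 1),
      ((n.choose l * m.descFactorial l * Real.Gamma ((n : ℝ) + m - l + α + 1) /
        (Real.Gamma (α + m + 1) * Real.Gamma (α + n + 1)) : ℝ) : ℂ) *
        ((1 - u) ^ (m - l) * (1 - v) ^ (n - l) * (u + v - 1) ^ l) := by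
  have step1 : ∑ j ∈ Finset.range (m + 1), ∑ k ∈ Finset.range (n + 1),
      (m.choose j : ℂ) * n.choose k *
        ((Real.Gamma (α + j + k + 1) / (Real.Gamma (α + j + 1) * Real.Gamma (α + k + 1)) : ℝ) : ℂ) *
        ((-u) ^ j * (-v) ^ k) =
      ∑ i ∈ Finset.range (min n m + 1),
        ((n.choose i * m.descFactorial i / Real.Gamma (α + i + 1) : ℝ) : ℂ) *
        ((u * v) ^ i * (1 - u) ^ (m - i) * (1 - v) ^ (n - i)) := by
    calc _ = ∑ j ∈ Finset.range (m + 1), ∑ k ∈ Finset.range (n + 1),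
        ∑ i ∈ Finset.range (min n m + 1),
        ((i.factorial / Real.Gamma (α + i + 1) : ℝ) : ℂ) *
          (((m.choose j : ℂ) * j.choose i * (-u) ^ j) * (n.choose k * k.choose i * (-v) ^ k)) := by
          refine Finset.sum_congr rfl fun j hj => Finset.sum_congr rfl fun k hk => ?_
          rw [← gamma_vandermonde hα (N := min n m) (by
            have := Finset.mem_range.1 hj; have := Finset.mem_range.1 hk; omega),
            Complex.ofReal_sum, Finset.mul_sum, Finset.sum_mul]
          refine Finset.sum_congr rfl fun i _ => ?_
          rw [Nat.descFactorial_eq_factorial_mul_choose]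
          push_cast
          ring
      _ = ∑ i ∈ Finset.range (min n m + 1), ((i.factorial / Real.Gamma (α + i + 1) : ℝ) : ℂ) *
          ((∑ j ∈ Finset.range (m + 1), (m.choose j : ℂ) * j.choose i * (-u) ^ j) *
          (∑ k ∈ Finset.range (n + 1), (n.choose k : ℂ) * k.choose i * (-v) ^ k)) := by
          simp_rw [Finset.sum_mul_sum, Finset.mul_sum]
          rw [Finset.sum_comm (s := Finset.range (min n m + 1))]
          exact Finset.sum_congr rfl fun j _ => Finset.sum_comm
      _ = _ := by
          refine Finset.sum_congr rfl fun i _ => ?_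
          rw [sum_choose_mul_choose_mul_pow, sum_choose_mul_choose_mul_pow,
            Nat.descFactorial_eq_factorial_mul_choose, ← sub_eq_add_neg, ← sub_eq_add_neg,
            show u * v = (-u) * (-v) by ring, mul_pow]
          push_cast
          ring
  rw [step1]
  -- Binomial expansion of `(uv)^i` with `uv = (u + v - 1) + (1 - u)(1 - v)`; zero terms are added
  -- so that the range of `l` does not depend on `i`.
  have step2 : ∀ i ∈ Finset.range (min n m + 1),
      (u * v) ^ i * (1 - u) ^ (m - i) * (1 - v) ^ (n - i) =
      ∑ l ∈ Finset.range (min n m + 1), (i.choose l : ℂ) *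
        ((1 - u) ^ (m - l) * (1 - v) ^ (n - l) * (u + v - 1) ^ l) := by
    intro i hi
    have hi' := Finset.mem_range.1 hi
    have hsub : ∑ l ∈ Finset.range (i + 1), (i.choose l : ℂ) *
        ((1 - u) ^ (m - l) * (1 - v) ^ (n - l) * (u + v - 1) ^ l) =
        ∑ l ∈ Finset.range (min n m + 1), (i.choose l : ℂ) *
        ((1 - u) ^ (m - l) * (1 - v) ^ (n - l) * (u + v - 1) ^ l) := by
      refine Finset.sum_subset (Finset.range_mono (by omega)) fun l _ hl => ?_
      rw [Nat.choose_eq_zero_of_lt (by simpa using hl)]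
      simp
    rw [← hsub, show u * v = (u + v - 1) + (1 - u) * (1 - v) by ring, add_pow, Finset.sum_mul,
      Finset.sum_mul]
    refine Finset.sum_congr rfl fun l hl => ?_
    have hl' := Finset.mem_range.1 hl
    rw [show m - l = (i - l) + (m - i) by omega, show n - l = (i - l) + (n - i) by omega,
      mul_pow, pow_add, pow_add]
    ring
  calc _ = ∑ i ∈ Finset.range (min n m + 1), ∑ l ∈ Finset.range (min n m + 1),
      ((n.choose i * m.descFactorial i / Real.Gamma (α + i + 1) * i.choose l : ℝ) : ℂ) *
        ((1 - u) ^ (m - l) * (1 - v) ^ (n - l) * (u + v - 1) ^ l) := by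
        refine Finset.sum_congr rfl fun i hi => ?_
        rw [step2 i hi, Finset.mul_sum]
        refine Finset.sum_congr rfl fun l _ => ?_
        push_cast
        ring
    _ = _ := by
        rw [Finset.sum_comm]
        refine Finset.sum_congr rfl fun l hl => ?_
        have hl' := Finset.mem_range.1 hl
        rw [← Finset.sum_mul, ← Complex.ofReal_sum,
          sum_choose_descFactorial_choose hα m n l (by omega) (by omega)]

/-! ### The Gamma integral with complex rate. -/

lemma integrableOn_rpow_mul_cexp {a : ℝ} (ha : 0 < a) {p : ℂ} (hp : 0 < p.re) :
    IntegrableOn (fun t : ℝ => ((t ^ (a - 1) : ℝ) : ℂ) * Complex.exp (-(p * t)))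
      (Set.Ioi 0) := by
  have h := integrableOn_rpow_mul_exp_neg_mul_rpow (s := a - 1) (p := 1) (b := p.re)
    (by linarith) one_pos hp
  refine Integrable.mono h (by fun_prop) ?_
  filter_upwards [ae_restrict_mem measurableSet_Ioi] with t _
  rw [norm_mul, norm_mul, Complex.norm_exp, Complex.norm_real, Real.norm_eq_abs (Real.exp _),
    Real.abs_exp]
  simp

/-- The Gamma integral with a complex rate. -/
lemma integral_rpow_mul_cexp {a : ℝ} (ha : 0 < a) {p : ℂ} (hp : 0 < p.re) :
    ∫ t in Set.Ioi (0 : ℝ), ((t ^ (a - 1) : ℝ) : ℂ) * Complex.exp (-(p * t)) =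
      Real.Gamma a * (p ^ (a : ℂ))⁻¹ := by
  -- The integral is the complex moment generating function of `t^(a-1) dt` at `-p`, hence analytic
  -- in `p` on the right half plane. The identity theorem extends the known formula from positive
  -- real rates.
  set μ : Measure ℝ := (volume.restrict (Set.Ioi (0 : ℝ))).withDensity
    (fun t => ENNReal.ofReal (t ^ (a - 1))) with hμ
  have hdens : Measurable (fun t : ℝ => ENNReal.ofReal (t ^ (a - 1))) := by fun_prop
  have hMGF : ∀ z : ℂ, ProbabilityTheory.complexMGF id μ z =
      ∫ t in Set.Ioi (0 : ℝ), ((t ^ (a - 1) : ℝ) : ℂ) * Complex.exp (z * t) := by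
    intro z
    rw [ProbabilityTheory.complexMGF, hμ, integral_withDensity_eq_integral_toReal_smul hdens
      (by simp)]
    refine setIntegral_congr_fun measurableSet_Ioi fun t ht => ?_
    have ht' : (0 : ℝ) < t := ht
    simp only [id]
    rw [ENNReal.toReal_ofReal (by positivity), Complex.real_smul]
  have hset : Set.Iio (0 : ℝ) ⊆ ProbabilityTheory.integrableExpSet id μ := by
    intro r hr
    have hr' : r < 0 := hr
    change Integrable (fun t : ℝ => Real.exp (r * t)) μ
    rw [hμ, integrable_withDensity_iff_integrable_smul₀' hdens.aemeasurable (by simp)]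
    have h := integrableOn_rpow_mul_exp_neg_mul_rpow (s := a - 1) (p := 1) (b := -r)
      (by linarith) one_pos (by linarith)
    refine IntegrableOn.congr_fun h (fun t ht => ?_) measurableSet_Ioi
    have ht' : (0 : ℝ) < t := ht
    simp only [smul_eq_mul, Real.rpow_one, neg_neg]
    rw [ENNReal.toReal_ofReal (by positivity)]
  set U : Set ℂ := {z | z.re < 0} with hU
  have hUo : IsOpen U := isOpen_lt Complex.continuous_re continuous_const
  have hf : AnalyticOnNhd ℂ (ProbabilityTheory.complexMGF id μ) U := by
    intro z hz
    refine ProbabilityTheory.analyticAt_complexMGF ?_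
    exact interior_mono hset (by rw [interior_Iio]; exact hz)
  have hg : AnalyticOnNhd ℂ (fun z : ℂ => (Real.Gamma a : ℂ) * ((-z) ^ (a : ℂ))⁻¹) U := by
    refine DifferentiableOn.analyticOnNhd (fun z hz => ?_) hUo
    have hz' : -z ∈ Complex.slitPlane := Or.inl (by simpa [hU] using hz)
    refine DifferentiableAt.differentiableWithinAt ?_
    refine DifferentiableAt.const_mul (DifferentiableAt.inv ?_ ?_) _
    · exact differentiableAt_id.neg.cpow_const hz'
    · rw [Complex.cpow_ne_zero_iff]
      exact Or.inl (Complex.slitPlane_ne_zero hz')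
  have hreal : ∀ r : ℝ, 0 < r → ProbabilityTheory.complexMGF id μ (-(r : ℂ)) =
      (Real.Gamma a : ℂ) * ((-(-(r : ℂ))) ^ (a : ℂ))⁻¹ := by
    intro r hr
    rw [hMGF]
    have h := Complex.integral_cpow_mul_exp_neg_mul_Ioi (a := (a : ℂ)) (r := r) (by simpa) hr
    rw [neg_neg, ← Complex.Gamma_ofReal, mul_comm, ← Complex.inv_cpow, ← one_div, ← h]
    · refine setIntegral_congr_fun measurableSet_Ioi fun t ht => ?_
      have ht' : (0 : ℝ) < t := ht
      rw [Complex.ofReal_cpow ht'.le]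
      push_cast
      rw [neg_mul]
    · rw [Complex.arg_ofReal_of_nonneg hr.le]
      exact Real.pi_pos.ne
  -- Real points accumulating at `-1` are enough for the identity theorem.
  have hfreq : ∃ᶠ z in 𝓝[≠] (-1 : ℂ), ProbabilityTheory.complexMGF id μ z =
      (Real.Gamma a : ℂ) * ((-z) ^ (a : ℂ))⁻¹ := by
    have ht : Tendsto (fun r : ℝ => -(r : ℂ)) (𝓝[≠] 1) (𝓝[≠] (-1 : ℂ)) := by
      refine tendsto_nhdsWithin_iff.2 ⟨?_, ?_⟩
      · have : ContinuousAt (fun r : ℝ => -(r : ℂ)) 1 := by fun_prop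
        have h2 := this.tendsto
        simp only [Complex.ofReal_one] at h2
        exact h2.mono_left nhdsWithin_le_nhds
      · filter_upwards [self_mem_nhdsWithin] with r hr
        simp only [Set.mem_compl_iff, Set.mem_singleton_iff, neg_inj] at hr ⊢
        exact_mod_cast hr
    refine ht.frequently (Eventually.frequently ?_)
    have : ∀ᶠ r : ℝ in 𝓝[≠] 1, 0 < r :=
      (lt_mem_nhds one_pos).filter_mono nhdsWithin_le_nhds
    filter_upwards [this] with r hr using hreal r hr
  have heq := hf.eqOn_of_preconnected_of_frequently_eq hg
    (convex_halfSpace_re_lt 0).isPreconnected (by simp [hU]) hfreq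
  have hp' : -p ∈ U := by simpa [hU] using hp
  have := heq hp'
  simp only [hMGF, neg_neg, neg_mul] at this
  exact this

/-! ### The affine representation on the Fourier side. -/

/-- On `L¹ ∩ L²` the `L²` inverse Fourier transform is given by the integral formula. -/
lemma fourierInv_toLp_ae {G : ℝ → ℂ} (h1 : Integrable G) (h2 : MemLp G 2) :
    (𝓕⁻ (h2.toLp G : L2R) : L2R) =ᵐ[volume] (𝓕⁻ G : ℝ → ℂ) := by
  have hcont : Continuous (𝓕⁻ G : ℝ → ℂ) :=
    VectorFourier.fourierIntegral_continuous (L := -innerₗ ℝ) Real.continuous_fourierChar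
      continuous_inner.neg h1
  -- Both sides are tested against smooth compactly supported `g`: as a distribution, the `L²`
  -- transform moves onto the Schwartz function; for integrable `G`, Fubini does the same for the
  -- integral transform.
  refine ae_eq_of_integral_contDiff_smul_eq ((Lp.memLp _).locallyIntegrable (by norm_num))
    hcont.locallyIntegrable fun g hg hc => ?_
  have hg₁ : HasCompactSupport (Complex.ofRealCLM ∘ g) := hc.comp_left rfl
  have hg₂ : ContDiff ℝ (⊤ : ℕ∞) (Complex.ofRealCLM ∘ g) := Complex.ofRealCLM.contDiff.comp hg
  set φ : SchwartzMap ℝ ℂ := hg₁.toSchwartzMap hg₂ with hφ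
  have hφg : ∀ x, φ x = (g x : ℂ) := fun x => rfl
  have hflip : ∫ ξ : ℝ, (𝓕⁻ (φ : ℝ → ℂ) : ℝ → ℂ) ξ • G ξ = ∫ x : ℝ, φ x • (𝓕⁻ G : ℝ → ℂ) x := by
    have h := VectorFourier.integral_fourierIntegral_smul_eq_flip (L := -innerₗ ℝ)
      (μ := volume) (ν := volume) (e := Real.fourierChar)
      Real.continuous_fourierChar continuous_inner.neg φ.integrable h1
    have hL : (-innerₗ ℝ).flip = -innerₗ ℝ := by
      ext
      simp
    rw [hL] at h
    exact h
  calc ∫ x, g x • (𝓕⁻ (h2.toLp G : L2R) : L2R) x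
      = ∫ x, φ x • (𝓕⁻ (h2.toLp G : L2R) : L2R) x := by
        simp [hφg]
    _ = ∫ x, (𝓕⁻ φ : SchwartzMap ℝ ℂ) x • (h2.toLp G : L2R) x := by
        rw [← Lp.toTemperedDistribution_apply, ← Lp.fourierInv_toTemperedDistribution_eq,
          TemperedDistribution.fourierInv_apply, Lp.toTemperedDistribution_apply]
    _ = ∫ ξ : ℝ, (𝓕⁻ (φ : ℝ → ℂ) : ℝ → ℂ) ξ • G ξ := by
        refine integral_congr_ae ?_
        filter_upwards [h2.coeFn_toLp] with x hx
        rw [hx, SchwartzMap.fourierInv_coe]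
    _ = ∫ x, g x • (𝓕⁻ G : ℝ → ℂ) x := by
        rw [hflip]
        simp [hφg]

/-- The Fourier side of `affineRep`. -/
noncomputable def affineHat (z : ℍ) (G : ℝ → ℂ) (η : ℝ) : ℂ :=
  ((Real.sqrt z.im : ℝ) : ℂ) * Complex.exp (-(2 * Real.pi * z.re * η : ℝ) * Complex.I) *
    G (z.im * η)

lemma fourierInv_affineHat (z : ℍ) (G : ℝ → ℂ) (t : ℝ) :
    (𝓕⁻ (affineHat z G) : ℝ → ℂ) t =
      (((Real.sqrt z.im)⁻¹ : ℝ) : ℂ) * (𝓕⁻ G : ℝ → ℂ) (z.im⁻¹ * (t - z.re)) := by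
  have hs := z.im_pos
  rw [Real.fourierInv_eq', Real.fourierInv_eq']
  set F : ℝ → ℂ := fun v => Complex.exp ((2 * Real.pi * inner ℝ v (z.im⁻¹ * (t - z.re)) : ℝ) *
    Complex.I) • G v with hF
  have h := Measure.integral_comp_mul_left F z.im
  have h2 : (fun v : ℝ => Complex.exp ((2 * Real.pi * inner ℝ v t : ℝ) * Complex.I) •
      affineHat z G v) = fun v => ((Real.sqrt z.im : ℝ) : ℂ) * F (z.im * v) := by
    funext v
    simp only [hF, affineHat, smul_eq_mul]
    have : Complex.exp ((2 * Real.pi * inner ℝ (z.im * v) (z.im⁻¹ * (t - z.re)) : ℝ) * Complex.I) =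
        Complex.exp ((2 * Real.pi * inner ℝ v t : ℝ) * Complex.I) *
        Complex.exp (-(2 * Real.pi * z.re * v : ℝ) * Complex.I) := by
      rw [← Complex.exp_add]
      congr 1
      simp only [RCLike.inner_apply, conj_trivial]
      have h3 : z.im⁻¹ * (t - z.re) * (z.im * v) = (t - z.re) * v := by field_simp
      rw [h3]
      push_cast
      ring
    rw [this]
    ring
  rw [h2, integral_const_mul, h, abs_of_pos (inv_pos.2 hs), Complex.real_smul, ← mul_assoc]
  congr 1
  rw [← Complex.ofReal_mul]
  congr 1
  have := Real.mul_self_sqrt hs.le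
  have h4 : Real.sqrt z.im ≠ 0 := (Real.sqrt_pos.2 hs).ne'
  field_simp
  linarith

lemma integrable_affineHat (z : ℍ) {G : ℝ → ℂ} (h1 : Integrable G) :
    Integrable (affineHat z G) := by
  refine Integrable.bdd_mul (c := Real.sqrt z.im) (h1.comp_mul_left' z.im_pos.ne')
    (by fun_prop) (Eventually.of_forall fun η => ?_)
  rw [norm_mul, ← Complex.ofReal_neg, Complex.norm_exp_ofReal_mul_I, mul_one, Complex.norm_real,
    Real.norm_of_nonneg (Real.sqrt_nonneg _)]

lemma memLp_affineHat (z : ℍ) {G : ℝ → ℂ} (h2 : MemLp G 2) : MemLp (affineHat z G) 2 := by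
  have h := (memLp_comp_affine h2 0 z.im⁻¹ (inv_ne_zero z.im_pos.ne')).const_mul
    ((Real.sqrt z.im : ℝ) : ℂ)
  have h' : MemLp (fun η => ((Real.sqrt z.im : ℝ) : ℂ) * G (z.im * η)) 2 volume := by
    simpa using h
  have hexp : AEStronglyMeasurable
      (fun η : ℝ => Complex.exp (-(2 * Real.pi * z.re * η : ℝ) * Complex.I)) volume := by fun_prop
  have heq : affineHat z G = fun η => Complex.exp (-(2 * Real.pi * z.re * η : ℝ) * Complex.I) *
      (((Real.sqrt z.im : ℝ) : ℂ) * G (z.im * η)) := by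
    funext η
    rw [affineHat]
    ring
  rw [heq]
  refine h'.of_le (hexp.mul h'.aestronglyMeasurable) (Eventually.of_forall fun η => ?_)
  rw [norm_mul, ← Complex.ofReal_neg, Complex.norm_exp_ofReal_mul_I, one_mul]

/-- Integrability of `G` makes both inverse transforms explicit integrals, so a substitution proves
the intertwining almost everywhere. -/
lemma affineRep_fourierInv (z : ℍ) {G : ℝ → ℂ} (h1 : Integrable G) (h2 : MemLp G 2) :
    affineRep z (𝓕⁻ (h2.toLp G : L2R)) = 𝓕⁻ ((memLp_affineHat z h2).toLp (affineHat z G) : L2R) := by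
  refine Lp.ext ?_
  have hq : Measure.QuasiMeasurePreserving (fun t : ℝ => z.im⁻¹ * (t - z.re)) volume volume := by
    have h1 : Measure.QuasiMeasurePreserving (fun t : ℝ => z.im⁻¹ * t) volume volume := by
      refine ⟨by fun_prop, ?_⟩
      rw [Real.map_volume_mul_left (inv_ne_zero z.im_pos.ne')]
      exact Measure.smul_absolutelyContinuous
    exact h1.comp (measurePreserving_sub_right volume z.re).quasiMeasurePreserving
  have hL : affineRep z (𝓕⁻ (h2.toLp G : L2R)) =ᵐ[volume] fun t =>
      (((Real.sqrt z.im)⁻¹ : ℝ) : ℂ) * (𝓕⁻ (h2.toLp G : L2R) : L2R) (z.im⁻¹ * (t - z.re)) :=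
    MemLp.coeFn_toLp _
  filter_upwards [hL, hq.ae (fourierInv_toLp_ae h1 h2),
    fourierInv_toLp_ae (integrable_affineHat z h1) (memLp_affineHat z h2)] with t e1 e2 e3
  rw [e1, e2, e3, fourierInv_affineHat]

lemma inner_affineRep_fourierInv (z w : ℍ) {G H : ℝ → ℂ} (hG1 : Integrable G) (hG2 : MemLp G 2)
    (hH1 : Integrable H) (hH2 : MemLp H 2) :
    inner ℂ (affineRep z (𝓕⁻ (hG2.toLp G : L2R))) (affineRep w (𝓕⁻ (hH2.toLp H : L2R))) =
      ∫ η, conj (affineHat z G η) * affineHat w H η := by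
  rw [affineRep_fourierInv z hG1, affineRep_fourierInv w hH1]
  have h : ∀ f g : L2R, inner ℂ (𝓕⁻ f : L2R) (𝓕⁻ g : L2R) = inner ℂ f g := fun f g =>
    (Lp.fourierTransformₗᵢ ℝ ℂ).symm.inner_map_map f g
  rw [h, L2.inner_def]
  refine integral_congr_ae ?_
  filter_upwards [(memLp_affineHat z hG2).coeFn_toLp, (memLp_affineHat w hH2).coeFn_toLp]
    with η e1 e2
  rw [e1, e2, RCLike.inner_apply, mul_comm]

/-! ### Inner products of affine translates as integrals and double sums. -/

lemma psiHat_of_pos {α : ℝ} (hα : 0 < α) (n : ℕ) {t : ℝ} (ht : 0 < t) :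
    psiHat α n t = ((Real.sqrt ((2 : ℝ) ^ (α + 2) * Real.pi * n.factorial /
        Real.Gamma (n + α + 1)) * (Real.Gamma (n + α + 1) / n.factorial) * t ^ (α / 2) *
        Real.exp (-t) * ∑ k ∈ Finset.range (n + 1),
          (n.choose k : ℝ) / Real.Gamma (α + k + 1) * (-(2 * t)) ^ k : ℝ) : ℂ) := by
  rw [psiHat, Set.indicator_of_mem (Set.mem_Ioi.2 ht), laguerre_eq hα]
  congr 1
  ring

lemma psiHat_of_nonpos (α : ℝ) (n : ℕ) {t : ℝ} (ht : t ≤ 0) : psiHat α n t = 0 := by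
  rw [psiHat, Set.indicator_of_notMem (by simpa using ht)]

lemma integrable_psiHat {α : ℝ} (hα : 0 < α) (n : ℕ) : Integrable (psiHat α n) := by
  have h : IntegrableOn (fun t : ℝ => ((Real.sqrt ((2 : ℝ) ^ (α + 2) * Real.pi * n.factorial /
        Real.Gamma (n + α + 1)) * (Real.Gamma (n + α + 1) / n.factorial) : ℝ) : ℂ) *
      ∑ k ∈ Finset.range (n + 1), (((n.choose k : ℝ) / Real.Gamma (α + k + 1) * (-2) ^ k : ℝ) : ℂ) *
        (((t ^ (α / 2 + k + 1 - 1) : ℝ) : ℂ) * Complex.exp (-((1 : ℂ) * t)))) (Set.Ioi 0) :=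
    (integrable_finsetSum _ fun k _ =>
      (integrableOn_rpow_mul_cexp (by positivity) (by simp)).const_mul _).const_mul _
  have h2 : psiHat α n = Set.indicator (Set.Ioi 0) (psiHat α n) := by
    funext t
    by_cases ht : 0 < t
    · rw [Set.indicator_of_mem (Set.mem_Ioi.2 ht)]
    · rw [Set.indicator_of_notMem (by simpa using ht), psiHat_of_nonpos α n (not_lt.1 ht)]
  rw [h2, integrable_indicator_iff measurableSet_Ioi]
  refine h.congr_fun (fun t ht => ?_) measurableSet_Ioi
  have ht' : (0 : ℝ) < t := ht
  simp only
  rw [psiHat_of_pos hα n ht']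
  push_cast
  rw [mul_assoc _ (Complex.exp _), mul_assoc _ (((t ^ (α / 2) : ℝ)) : ℂ)]
  congr 1
  rw [Finset.mul_sum, Finset.mul_sum]
  refine Finset.sum_congr rfl fun k _ => ?_
  rw [add_sub_cancel_right, Real.rpow_add ht', Real.rpow_natCast, neg_eq_neg_one_mul (2 * (t : ℂ)),
    mul_pow, mul_pow, neg_eq_neg_one_mul (2 : ℂ), mul_pow, one_mul]
  push_cast
  ring

/-- The factor `(2π)⁻¹` comes from the frequency substitution `ξ = 2πη`. Since `psiHat` is real,
conjugation affects only the phase. -/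
lemma inner_affineRep_psi_eq_integral {α : ℝ} (hα : 0 < α) (n m : ℕ) (z w : ℍ) :
    inner ℂ (affineRep z (psi α hα n : L2R)) (affineRep w (psi α hα m : L2R)) =
      (((2 * Real.pi)⁻¹ * Real.sqrt z.im * Real.sqrt w.im : ℝ) : ℂ) *
        ∫ ξ in Set.Ioi (0 : ℝ), Complex.exp (((z.re - w.re : ℝ) : ℂ) * ξ * Complex.I) *
          (psiHat α n (z.im * ξ) * psiHat α m (w.im * ξ)) := by
  have hcomp : ∀ n, (fun η : ℝ => psiHat α n (((2 * Real.pi)⁻¹)⁻¹ * (η - 0))) =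
      fun η => psiHat α n (2 * Real.pi * η) := by
    intro n; funext η; simp
  have hint : ∀ n, Integrable (fun η : ℝ => psiHat α n (((2 * Real.pi)⁻¹)⁻¹ * (η - 0))) := by
    intro n
    rw [hcomp]
    exact (integrable_psiHat hα n).comp_mul_left' Real.two_pi_pos.ne'
  have h := inner_affineRep_fourierInv z w (hint n) (memLp_comp_affine (memLp_psiHat α hα n) 0
    (2 * Real.pi)⁻¹ (inv_ne_zero Real.two_pi_pos.ne')) (hint m) (memLp_comp_affine
    (memLp_psiHat α hα m) 0 (2 * Real.pi)⁻¹ (inv_ne_zero Real.two_pi_pos.ne'))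
  change inner ℂ (affineRep z (𝓕⁻ (psiHatL2 α hα n))) (affineRep w (𝓕⁻ (psiHatL2 α hα m))) = _
  refine h.trans ?_
  rw [hcomp, hcomp]
  set F : ℝ → ℂ := fun ξ => Complex.exp (((z.re - w.re : ℝ) : ℂ) * ξ * Complex.I) *
    (psiHat α n (z.im * ξ) * psiHat α m (w.im * ξ)) with hF
  have hreal : ∀ t, conj (psiHat α n t) = psiHat α n t := by
    intro t
    rcases lt_or_ge 0 t with ht | ht
    · rw [psiHat_of_pos hα n ht, Complex.conj_ofReal]
    · rw [psiHat_of_nonpos α n ht, map_zero]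
  have hpt : ∀ η : ℝ, conj (affineHat z (fun η => psiHat α n (2 * Real.pi * η)) η) *
      affineHat w (fun η => psiHat α m (2 * Real.pi * η)) η =
      ((Real.sqrt z.im * Real.sqrt w.im : ℝ) : ℂ) * F (2 * Real.pi * η) := by
    intro η
    simp only [affineHat, hF]
    rw [map_mul, map_mul, hreal, Complex.conj_ofReal, ← Complex.exp_conj,
      show 2 * Real.pi * (z.im * η) = z.im * (2 * Real.pi * η) by ring,
      show 2 * Real.pi * (w.im * η) = w.im * (2 * Real.pi * η) by ring]
    have he : Complex.exp (((z.re - w.re : ℝ) : ℂ) * (2 * Real.pi * η : ℝ) * Complex.I) =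
        Complex.exp (conj (-((2 * Real.pi * z.re * η : ℝ) : ℂ) * Complex.I)) *
        Complex.exp (-((2 * Real.pi * w.re * η : ℝ) : ℂ) * Complex.I) := by
      rw [← Complex.exp_add, map_mul, map_neg, Complex.conj_ofReal, Complex.conj_I]
      congr 1
      push_cast
      ring
    rw [he]
    push_cast
    ring
  simp_rw [hpt]
  rw [integral_const_mul, Measure.integral_comp_mul_left F, Complex.real_smul,
    abs_of_pos (inv_pos.2 Real.two_pi_pos)]
  have hsupp : ∫ ξ in Set.Ioi (0 : ℝ), F ξ = ∫ ξ, F ξ := by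
    refine setIntegral_eq_integral_of_forall_compl_eq_zero fun ξ hξ => ?_
    have hξ' : z.im * ξ ≤ 0 := mul_nonpos_of_nonneg_of_nonpos z.im_pos.le (by simpa using hξ)
    simp only [hF]
    rw [psiHat_of_nonpos α n hξ', zero_mul, mul_zero]
  rw [hsupp]
  push_cast
  ring

/-- The power law holds for the principal branch because `r > 0` and `p` lies in the right half
plane, away from the cut. -/
lemma ofReal_div_cpow {r : ℝ} (hr : 0 < r) {p : ℂ} (hp : 0 < p.re) (c : ℝ) :
    ((r : ℂ) / p) ^ (c : ℂ) = ((r ^ c : ℝ) : ℂ) * (p ^ (c : ℂ))⁻¹ := by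
  have hp0 : p ≠ 0 := fun h => by simp [h] at hp
  have harg : p.arg ≠ Real.pi := by
    intro h
    have := Complex.arg_eq_pi_iff.1 h
    linarith [this.1]
  rw [div_eq_mul_inv, ← Complex.inv_cpow _ _ harg, Complex.cpow_def_of_ne_zero
    (mul_ne_zero (by exact_mod_cast hr.ne') (inv_ne_zero hp0)),
    Complex.log_ofReal_mul hr (inv_ne_zero hp0), add_mul, Complex.exp_add,
    ← Complex.cpow_def_of_ne_zero (inv_ne_zero hp0), Complex.ofReal_cpow hr.le,
    Complex.cpow_def_of_ne_zero (Complex.ofReal_ne_zero.2 hr.ne'), Complex.ofReal_log hr.le]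

lemma integral_psiHat_mul_psiHat {α : ℝ} (hα : 0 < α) (n m : ℕ) (x : ℝ) {s s' : ℝ} (hs : 0 < s)
    (hs' : 0 < s') {p : ℂ} (hp : p = s + s' - x * Complex.I) :
    ∫ ξ in Set.Ioi (0 : ℝ), Complex.exp ((x : ℂ) * ξ * Complex.I) *
        (psiHat α n (s * ξ) * psiHat α m (s' * ξ)) =
      ((Real.sqrt ((2 : ℝ) ^ (α + 2) * Real.pi * n.factorial / Real.Gamma (n + α + 1)) *
        Real.sqrt ((2 : ℝ) ^ (α + 2) * Real.pi * m.factorial / Real.Gamma (m + α + 1)) *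
        (Real.Gamma (n + α + 1) / n.factorial) * (Real.Gamma (m + α + 1) / m.factorial) *
        (s * s') ^ (α / 2) : ℝ) : ℂ) * (p ^ ((α + 1 : ℝ) : ℂ))⁻¹ *
      ∑ j ∈ Finset.range (m + 1), ∑ k ∈ Finset.range (n + 1),
        (m.choose j : ℂ) * n.choose k *
          ((Real.Gamma (α + j + k + 1) / (Real.Gamma (α + j + 1) * Real.Gamma (α + k + 1)) : ℝ) : ℂ) *
          ((-(2 * s' / p)) ^ j * (-(2 * s / p)) ^ k) := by
  have hpre : 0 < p.re := by
    rw [hp]; simp; positivity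
  have hp0 : p ≠ 0 := fun h => by simp [h] at hpre
  set A : ℂ := ((Real.sqrt ((2 : ℝ) ^ (α + 2) * Real.pi * n.factorial / Real.Gamma (n + α + 1)) *
        Real.sqrt ((2 : ℝ) ^ (α + 2) * Real.pi * m.factorial / Real.Gamma (m + α + 1)) *
        (Real.Gamma (n + α + 1) / n.factorial) * (Real.Gamma (m + α + 1) / m.factorial) *
        (s * s') ^ (α / 2) : ℝ) : ℂ) with hA
  have hpt : ∀ ξ ∈ Set.Ioi (0 : ℝ), Complex.exp ((x : ℂ) * ξ * Complex.I) *
        (psiHat α n (s * ξ) * psiHat α m (s' * ξ)) =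
      A * ∑ j ∈ Finset.range (m + 1), ∑ k ∈ Finset.range (n + 1),
        ((((m.choose j : ℝ) / Real.Gamma (α + j + 1) * (n.choose k / Real.Gamma (α + k + 1)) *
          ((-(2 * s')) ^ j * (-(2 * s)) ^ k) : ℝ) : ℂ)) *
        (((ξ ^ ((α + j + k + 1) - 1) : ℝ) : ℂ) * Complex.exp (-(p * ξ))) := by
    intro ξ hξ
    have hξ' : (0 : ℝ) < ξ := hξ
    rw [psiHat_of_pos hα n (by positivity), psiHat_of_pos hα m (by positivity)]
    have hexp : Complex.exp (-(p * ξ)) = Complex.exp ((x : ℂ) * ξ * Complex.I) *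
        (Complex.exp (-(s * ξ : ℝ)) * Complex.exp (-(s' * ξ : ℝ))) := by
      rw [← Complex.exp_add, ← Complex.exp_add, hp]
      congr 1
      push_cast
      ring
    have hpow : (s * ξ) ^ (α / 2) * (s' * ξ) ^ (α / 2) = (s * s') ^ (α / 2) * ξ ^ α := by
      rw [← Real.mul_rpow (by positivity) (by positivity),
        show s * ξ * (s' * ξ) = (s * s') * (ξ * ξ) by ring,
        Real.mul_rpow (by positivity) (by positivity), Real.mul_rpow hξ'.le hξ'.le,
        ← Real.rpow_add hξ', add_halves]
    have hsum : (∑ k ∈ Finset.range (n + 1),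
          (n.choose k : ℝ) / Real.Gamma (α + k + 1) * (-(2 * (s * ξ))) ^ k) *
        (∑ k ∈ Finset.range (m + 1),
          (m.choose k : ℝ) / Real.Gamma (α + k + 1) * (-(2 * (s' * ξ))) ^ k) * ξ ^ α =
        ∑ j ∈ Finset.range (m + 1), ∑ k ∈ Finset.range (n + 1),
        ((m.choose j : ℝ) / Real.Gamma (α + j + 1) * (n.choose k / Real.Gamma (α + k + 1)) *
          ((-(2 * s')) ^ j * (-(2 * s)) ^ k)) * ξ ^ ((α + j + k + 1) - 1) := by
      rw [mul_comm (∑ k ∈ Finset.range (n + 1), _), Finset.sum_mul_sum, Finset.sum_mul]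
      refine Finset.sum_congr rfl fun j _ => ?_
      rw [Finset.sum_mul]
      refine Finset.sum_congr rfl fun k _ => ?_
      rw [add_sub_cancel_right, Real.rpow_add hξ', Real.rpow_add hξ', Real.rpow_natCast,
        Real.rpow_natCast, show -(2 * (s' * ξ)) = -(2 * s') * ξ by ring,
        show -(2 * (s * ξ)) = -(2 * s) * ξ by ring, mul_pow, mul_pow]
      ring
    have hC : ∑ j ∈ Finset.range (m + 1), ∑ k ∈ Finset.range (n + 1),
        ((((m.choose j : ℝ) / Real.Gamma (α + j + 1) * (n.choose k / Real.Gamma (α + k + 1)) *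
          ((-(2 * s')) ^ j * (-(2 * s)) ^ k) : ℝ) : ℂ)) *
        (((ξ ^ ((α + j + k + 1) - 1) : ℝ) : ℂ) * Complex.exp (-(p * ξ))) =
        ((∑ j ∈ Finset.range (m + 1), ∑ k ∈ Finset.range (n + 1),
        ((m.choose j : ℝ) / Real.Gamma (α + j + 1) * (n.choose k / Real.Gamma (α + k + 1)) *
          ((-(2 * s')) ^ j * (-(2 * s)) ^ k)) * ξ ^ ((α + j + k + 1) - 1) : ℝ) : ℂ) *
          Complex.exp (-(p * ξ)) := by
      rw [Complex.ofReal_sum, Finset.sum_mul]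
      refine Finset.sum_congr rfl fun j _ => ?_
      rw [Complex.ofReal_sum, Finset.sum_mul]
      refine Finset.sum_congr rfl fun k _ => ?_
      simp only [Complex.ofReal_mul]
      ring
    rw [hC, ← hsum, hexp, hA]
    generalize (∑ k ∈ Finset.range (n + 1),
          (n.choose k : ℝ) / Real.Gamma (α + k + 1) * (-(2 * (s * ξ))) ^ k) = S₁
    generalize (∑ k ∈ Finset.range (m + 1),
          (m.choose k : ℝ) / Real.Gamma (α + k + 1) * (-(2 * (s' * ξ))) ^ k) = S₂
    have hpow' : (((s * ξ) ^ (α / 2) : ℝ) : ℂ) * (((s' * ξ) ^ (α / 2) : ℝ) : ℂ) =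
        (((s * s') ^ (α / 2) : ℝ) : ℂ) * ((ξ ^ α : ℝ) : ℂ) := by
      exact_mod_cast hpow
    simp only [Complex.ofReal_mul, Complex.ofReal_exp, Complex.ofReal_neg] at hpow' ⊢
    linear_combination (Complex.exp ((x : ℂ) * ξ * Complex.I) *
      Complex.exp (-((s : ℂ) * ξ)) * Complex.exp (-((s' : ℂ) * ξ)) * S₁ * S₂ *
      (Real.sqrt ((2 : ℝ) ^ (α + 2) * Real.pi * n.factorial / Real.Gamma (n + α + 1)) : ℂ) *
      (Real.sqrt ((2 : ℝ) ^ (α + 2) * Real.pi * m.factorial / Real.Gamma (m + α + 1)) : ℂ) *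
      ((Real.Gamma (n + α + 1) / n.factorial : ℝ) : ℂ) *
      ((Real.Gamma (m + α + 1) / m.factorial : ℝ) : ℂ)) * hpow'
  have hint : ∀ j k : ℕ, IntegrableOn (fun ξ : ℝ => ((((m.choose j : ℝ) / Real.Gamma (α + j + 1) *
      (n.choose k / Real.Gamma (α + k + 1)) * ((-(2 * s')) ^ j * (-(2 * s)) ^ k) : ℝ) : ℂ)) *
        (((ξ ^ ((α + j + k + 1) - 1) : ℝ) : ℂ) * Complex.exp (-(p * ξ)))) (Set.Ioi 0) :=
    fun j k => (integrableOn_rpow_mul_cexp (by positivity) hpre).const_mul _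
  rw [setIntegral_congr_fun measurableSet_Ioi hpt, integral_const_mul,
    integral_finsetSum _ fun j _ => integrable_finsetSum _ fun k _ => hint j k, mul_assoc]
  congr 1
  rw [Finset.mul_sum]
  refine Finset.sum_congr rfl fun j _ => ?_
  rw [integral_finsetSum _ fun k _ => hint j k, Finset.mul_sum]
  refine Finset.sum_congr rfl fun k _ => ?_
  rw [integral_const_mul, integral_rpow_mul_cexp (by positivity) hpre]
  -- Splitting off the integer powers leaves one branch-dependent factor `p^(α+1)` common to all
  -- terms; the rest forms powers of `s/p` and `s'/p`.
  have hcp : p ^ ((α + j + k + 1 : ℝ) : ℂ) = p ^ ((α + 1 : ℝ) : ℂ) * p ^ j * p ^ k := by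
    rw [← Complex.cpow_natCast, ← Complex.cpow_natCast, ← Complex.cpow_add _ _ hp0,
      ← Complex.cpow_add _ _ hp0]
    congr 1
    push_cast
    ring
  rw [hcp, ← neg_div, ← neg_div, div_pow, div_pow]
  push_cast
  have h1 : ((Real.Gamma (α + j + 1) : ℝ) : ℂ) ≠ 0 := by
    exact_mod_cast (Real.Gamma_pos_of_pos (by positivity)).ne'
  have h2 : ((Real.Gamma (α + k + 1) : ℝ) : ℂ) ≠ 0 := by
    exact_mod_cast (Real.Gamma_pos_of_pos (by positivity)).ne'
  have h3 : p ^ ((α : ℂ) + 1) ≠ 0 := by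
    rw [Complex.cpow_ne_zero_iff]; exact Or.inl hp0
  field_simp

lemma affine_const_eq {α : ℝ} (hα : 0 < α) (n m : ℕ) {s s' : ℝ} (hs : 0 < s) (hs' : 0 < s') :
    (2 * Real.pi)⁻¹ * Real.sqrt s * Real.sqrt s' *
      (Real.sqrt ((2 : ℝ) ^ (α + 2) * Real.pi * n.factorial / Real.Gamma (n + α + 1)) *
        Real.sqrt ((2 : ℝ) ^ (α + 2) * Real.pi * m.factorial / Real.Gamma (m + α + 1)) *
        (Real.Gamma (n + α + 1) / n.factorial) * (Real.Gamma (m + α + 1) / m.factorial) *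
        (s * s') ^ (α / 2)) =
      Real.sqrt (n.factorial * m.factorial / (Real.Gamma (n + α + 1) * Real.Gamma (m + α + 1))) /
        (n.factorial * m.factorial) * (Real.Gamma (n + α + 1) * Real.Gamma (m + α + 1)) *
        (2 * Real.sqrt (s * s')) ^ (α + 1) := by
  have h1 : 0 < Real.Gamma (n + α + 1) := Real.Gamma_pos_of_pos (by positivity)
  have h2 : 0 < Real.Gamma (m + α + 1) := Real.Gamma_pos_of_pos (by positivity)
  have hss : 0 < s * s' := mul_pos hs hs'
  have e1 : Real.sqrt ((2 : ℝ) ^ (α + 2) * Real.pi * n.factorial / Real.Gamma (n + α + 1)) *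
        Real.sqrt ((2 : ℝ) ^ (α + 2) * Real.pi * m.factorial / Real.Gamma (m + α + 1)) =
      (2 : ℝ) ^ (α + 2) * Real.pi * Real.sqrt (n.factorial * m.factorial /
        (Real.Gamma (n + α + 1) * Real.Gamma (m + α + 1))) := by
    rw [← Real.sqrt_mul (by positivity), ← Real.sqrt_sq
      (show 0 ≤ (2 : ℝ) ^ (α + 2) * Real.pi by positivity), ← Real.sqrt_mul (by positivity),
      Real.sqrt_sq (by positivity)]
    congr 1
    field_simp
  have e2 : (2 * Real.sqrt (s * s')) ^ (α + 1) =
      (2 : ℝ) ^ (α + 1) * ((Real.sqrt s * Real.sqrt s') * (s * s') ^ (α / 2)) := by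
    rw [Real.mul_rpow (by norm_num) (Real.sqrt_nonneg _), Real.rpow_add_one
      (Real.sqrt_pos.2 hss).ne' α, Real.sqrt_eq_rpow (s * s'), ← Real.rpow_mul hss.le,
      ← Real.sqrt_eq_rpow, Real.sqrt_mul hs.le, show 1 / 2 * α = α / 2 by ring]
    ring
  have e3 : (2 : ℝ) ^ (α + 2) = 2 ^ (α + 1) * 2 := by
    rw [← Real.rpow_add_one (by norm_num)]; ring_nf
  rw [e1, e2, e3]
  field_simp

/-! ### Half-plane ratios and the closed form of the inner products. -/

lemma coe_sub_conj_coe_ne_zero (z w : ℍ) : (z : ℂ) - conj (w : ℂ) ≠ 0 := by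
  intro h
  have h2 := congrArg Complex.im h
  simp only [Complex.sub_im, Complex.conj_im, Complex.zero_im, UpperHalfPlane.coe_im] at h2
  have := z.im_pos
  have := w.im_pos
  linarith

lemma affine_denominator_eq (z w : ℍ) : Complex.I * (conj (w : ℂ) - (z : ℂ)) =
    z.im + w.im - ((z.re - w.re : ℝ) : ℂ) * Complex.I := by
  apply Complex.ext <;> simp

lemma affine_denominator_re_pos (z w : ℍ) : 0 < (Complex.I * (conj (w : ℂ) - (z : ℂ))).re := by
  have := z.im_pos
  have := w.im_pos
  rw [affine_denominator_eq]
  simp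
  positivity

/-- Geometric values of `1 - u`, `1 - v` and `u + v - 1` for `u = 2s'/p`, `v = 2s/p`, where `p =
i(w̄ - z)`. -/
lemma affine_ratio_eq (z w : ℍ) :
    (1 - 2 * (w.im : ℂ) / (Complex.I * (conj (w : ℂ) - (z : ℂ))) =
      ((z : ℂ) - w) / (z - conj (w : ℂ))) ∧
    (1 - 2 * (z.im : ℂ) / (Complex.I * (conj (w : ℂ) - (z : ℂ))) =
      (conj (z : ℂ) - conj (w : ℂ)) / (z - conj (w : ℂ))) ∧
    (2 * (w.im : ℂ) / (Complex.I * (conj (w : ℂ) - (z : ℂ))) +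
      2 * (z.im : ℂ) / (Complex.I * (conj (w : ℂ) - (z : ℂ))) - 1 =
      ((w : ℂ) - conj (z : ℂ)) / (z - conj (w : ℂ))) := by
  have hI : Complex.I ≠ 0 := Complex.I_ne_zero
  have hp0 : Complex.I * (conj (w : ℂ) - (z : ℂ)) ≠ 0 := fun h => by
    have := affine_denominator_re_pos z w
    simp [h] at this
  have ediv : ∀ q : ℂ, q / ((z : ℂ) - conj (w : ℂ)) =
      (-Complex.I * q) / (Complex.I * (conj (w : ℂ) - (z : ℂ))) := by
    intro q
    rw [show Complex.I * (conj (w : ℂ) - (z : ℂ)) = -Complex.I * ((z : ℂ) - conj (w : ℂ)) by ring,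
      mul_div_mul_left _ _ (neg_ne_zero.2 hI)]
  have hp := affine_denominator_eq z w
  refine ⟨?_, ?_, ?_⟩
  · rw [ediv, eq_div_iff hp0, sub_mul, div_mul_cancel₀ _ hp0, hp]
    apply Complex.ext <;> simp
    ring
  · rw [ediv, eq_div_iff hp0, sub_mul, div_mul_cancel₀ _ hp0, hp]
    apply Complex.ext <;> simp
    ring
  · rw [ediv, eq_div_iff hp0, sub_mul, add_mul, div_mul_cancel₀ _ hp0, div_mul_cancel₀ _ hp0, hp]
    apply Complex.ext <;> simp
    ring

/-- The inner products of the translates and dilates of the functions `ψ_n^α`. -/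
lemma inner_affineRep_psi {α : ℝ} (hα : 0 < α) (n m : ℕ) (z w : ℍ) :
    inner ℂ (affineRep z (psi α hα n : L2R)) (affineRep w (psi α hα m : L2R)) =
      ((Real.sqrt (n.factorial * m.factorial / (Real.Gamma (n + α + 1) * Real.Gamma (m + α + 1))) /
        (n.factorial * m.factorial) : ℝ) : ℂ) *
      (2 * (Real.sqrt (z.im * w.im) : ℂ) /
          (Complex.I * (conj (w : ℂ) - (z : ℂ)))) ^ ((α : ℂ) + 1) *
      ∑ l ∈ Finset.range (min n m + 1),
        ((n.choose l * m.descFactorial l * Real.Gamma ((n : ℝ) + m - l + α + 1) : ℝ) : ℂ) *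
        ((((z : ℂ) - w) / (z - conj (w : ℂ))) ^ (m - l) *
          ((conj (z : ℂ) - conj (w : ℂ)) / (z - conj (w : ℂ))) ^ (n - l) *
          (((w : ℂ) - conj (z : ℂ)) / (z - conj (w : ℂ))) ^ l) := by
  have hz := z.im_pos
  have hw := w.im_pos
  have h1 : Real.Gamma (α + n + 1) ≠ 0 := (Real.Gamma_pos_of_pos (by positivity)).ne'
  have h2 : Real.Gamma (α + m + 1) ≠ 0 := (Real.Gamma_pos_of_pos (by positivity)).ne'
  have hpre := affine_denominator_re_pos z w
  have hp' := affine_denominator_eq z w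
  obtain ⟨eu, ev, euv⟩ := affine_ratio_eq z w
  rw [inner_affineRep_psi_eq_integral, integral_psiHat_mul_psiHat hα n m _ hz hw hp',
    double_sum_eq hα.le, eu, ev, euv, ← mul_assoc, ← mul_assoc, ← Complex.ofReal_mul,
    affine_const_eq hα n m hz hw]
  have hr : 0 < 2 * Real.sqrt (z.im * w.im) := by positivity
  have hc := ofReal_div_cpow hr hpre (α + 1)
  rw [Complex.ofReal_mul, Complex.ofReal_ofNat, Complex.ofReal_add, Complex.ofReal_one] at hc
  rw [hc, Complex.ofReal_add, Complex.ofReal_one, Finset.mul_sum, Finset.mul_sum]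
  refine Finset.sum_congr rfl fun l _ => ?_
  have hreal : ∀ K r c : ℝ, K * (Real.Gamma (n + α + 1) * Real.Gamma (m + α + 1)) * r *
      (c / (Real.Gamma (α + m + 1) * Real.Gamma (α + n + 1))) = K * r * c := by
    intro K r c
    rw [add_comm (n : ℝ) α, add_comm (m : ℝ) α]
    field_simp
  have hcplx : ∀ (K r c : ℝ) (q y : ℂ), ((K * (Real.Gamma (n + α + 1) * Real.Gamma (m + α + 1)) * r :
      ℝ) : ℂ) * q * (((c / (Real.Gamma (α + m + 1) * Real.Gamma (α + n + 1)) : ℝ) : ℂ) * y) =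
      (K : ℂ) * (r * q) * (c * y) := by
    intro K r c q y
    have h := congrArg (fun t : ℝ => (t : ℂ)) (hreal K r c)
    simp only [Complex.ofReal_mul] at h ⊢
    linear_combination (q * y) * h
  exact hcplx _ _ _ _ _

/-! ### The admissibility constant. -/

lemma admissibilityConst_psi {α : ℝ} (hα : 0 < α) (n : ℕ) :
    admissibilityConst (psi α hα n) = ENNReal.ofReal (4 * Real.pi / α) := by
  have hΓ : 0 < Real.Gamma (n + α + 1) := Real.Gamma_pos_of_pos (by positivity)
  -- `B` is the squared normalization of `psiHat`; the exponent `α + j + k - 1` in `f` includes the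
  -- weight `1/t`.
  set B : ℝ := (2 : ℝ) ^ (α + 2) * Real.pi * n.factorial / Real.Gamma (n + α + 1) *
    (Real.Gamma (n + α + 1) / n.factorial) ^ 2 with hB
  set f : ℝ → ℝ := fun t => B * ∑ j ∈ Finset.range (n + 1), ∑ k ∈ Finset.range (n + 1),
    ((n.choose j : ℝ) / Real.Gamma (α + j + 1) * (n.choose k / Real.Gamma (α + k + 1)) *
        ((-1) ^ j * (-1) ^ k) * 2 ^ (j + k)) * (t ^ ((α + j + k) - 1) * Real.exp (-(2 * t))) with hf
  have hpt : ∀ t : ℝ, 0 < t → ‖psiHat α n t‖ ^ 2 / t = f t := by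
    intro t ht
    rw [psiHat_of_pos hα n ht, Complex.norm_real, Real.norm_eq_abs, sq_abs, mul_pow, mul_pow,
      mul_pow, mul_pow, Real.sq_sqrt (by positivity), sq (Finset.sum _ _), Finset.sum_mul_sum]
    have h1 : (t ^ (α / 2)) ^ 2 = t ^ α := by
      rw [← Real.rpow_natCast, ← Real.rpow_mul ht.le]
      norm_num
    have h2 : Real.exp (-t) ^ 2 = Real.exp (-(2 * t)) := by
      rw [← Real.exp_nat_mul]
      push_cast
      ring_nf
    rw [h1, h2, ← hB, hf, mul_assoc, mul_assoc, mul_div_assoc]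
    congr 1
    rw [Finset.mul_sum, Finset.mul_sum, Finset.sum_div]
    refine Finset.sum_congr rfl fun j _ => ?_
    rw [Finset.mul_sum, Finset.mul_sum, Finset.sum_div]
    refine Finset.sum_congr rfl fun k _ => ?_
    rw [Real.rpow_sub_one ht.ne', Real.rpow_add ht, Real.rpow_add ht, Real.rpow_natCast,
      Real.rpow_natCast, show -(2 * t) = -1 * 2 * t by ring, mul_pow, mul_pow, mul_pow, mul_pow,
      pow_add]
    ring
  have hint : ∀ j k : ℕ, IntegrableOn (fun t : ℝ =>
      ((n.choose j : ℝ) / Real.Gamma (α + j + 1) * (n.choose k / Real.Gamma (α + k + 1)) *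
        ((-1) ^ j * (-1) ^ k) * 2 ^ (j + k)) * (t ^ ((α + j + k) - 1) * Real.exp (-(2 * t))))
      (Set.Ioi 0) := by
    intro j k
    have h := integrableOn_rpow_mul_exp_neg_mul_rpow (s := (α + j + k) - 1) (p := 1) (b := 2)
      (by have : (0 : ℝ) < α + j + k := by positivity
          linarith) one_pos two_pos
    simp only [Real.rpow_one, neg_mul] at h
    exact h.const_mul _
  have hfint : IntegrableOn f (Set.Ioi 0) :=
    (integrable_finsetSum _ fun j _ => integrable_finsetSum _ fun k _ => hint j k).const_mul _
  have hval : ∫ t in Set.Ioi (0 : ℝ), f t = 4 * Real.pi / α := by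
    rw [hf, integral_const_mul,
      integral_finsetSum _ fun j _ => integrable_finsetSum _ fun k _ => hint j k]
    have : ∑ j ∈ Finset.range (n + 1), ∫ t in Set.Ioi (0 : ℝ), ∑ k ∈ Finset.range (n + 1),
        ((n.choose j : ℝ) / Real.Gamma (α + j + 1) * (n.choose k / Real.Gamma (α + k + 1)) *
        ((-1) ^ j * (-1) ^ k) * 2 ^ (j + k)) * (t ^ ((α + j + k) - 1) * Real.exp (-(2 * t))) =
        ((2 : ℝ) ^ α)⁻¹ * (n.factorial / (α * Real.Gamma (α + n + 1))) := by
      rw [← double_sum_admissibility hα n, Finset.mul_sum]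
      refine Finset.sum_congr rfl fun j _ => ?_
      rw [integral_finsetSum _ fun k _ => hint j k, Finset.mul_sum]
      refine Finset.sum_congr rfl fun k _ => ?_
      rw [integral_const_mul, Real.integral_rpow_mul_exp_neg_mul_Ioi (by positivity) two_pos,
        one_div, Real.inv_rpow two_pos.le, Real.rpow_add two_pos, Real.rpow_add two_pos,
        Real.rpow_natCast, Real.rpow_natCast, pow_add]
      have : (2 : ℝ) ^ α ≠ 0 := by positivity
      field_simp
    -- The rate `2` has contributed `2^(-α)`, its `2^(-j-k)` cancelling the Laguerre arguments; with
    -- `2^(α+2)` from `B` this leaves the factor `4`.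
    rw [this, hB, Real.rpow_add two_pos, add_comm α (n : ℝ)]
    field_simp
    norm_num
  rw [← hval, ofReal_integral_eq_lintegral_ofReal hfint]
  · rw [admissibilityConst]
    refine lintegral_congr_ae ?_
    filter_upwards [ae_restrict_mem measurableSet_Ioi, ae_restrict_of_ae (fourier_psi α hα n)]
      with t ht hψ
    have ht' : (0 : ℝ) < t := ht
    rw [hψ, ← hpt t ht', ENNReal.ofReal_div_of_pos ht', ENNReal.ofReal_pow (norm_nonneg _),
      ofReal_norm]
  · filter_upwards [ae_restrict_mem measurableSet_Ioi] with t ht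
    have ht' : (0 : ℝ) < t := ht
    rw [← hpt t ht']
    simp only [Pi.zero_apply]
    positivity

/-! ### Jacobi and Zernike functions, and the reproducing kernel. -/

lemma choose_mul_descFactorial_comm (n m l : ℕ) :
    n.choose l * m.descFactorial l = m.choose l * n.descFactorial l := by
  rw [Nat.descFactorial_eq_factorial_mul_choose, Nat.descFactorial_eq_factorial_mul_choose]
  ring

/-- Reversing the summation, `k = N - l`, puts the Jacobi polynomial in the order produced by
`double_sum_eq`. -/
lemma jacobi_one_sub_two_mul {α : ℝ} {N M : ℕ} (h : N ≤ M) (t : ℝ) :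
    jacobi N ((M : ℝ) - N) α (1 - 2 * t) = 1 / (N.factorial * Real.Gamma (M + α + 1)) *
      ∑ l ∈ Finset.range (N + 1), (N.choose l : ℝ) * M.descFactorial l *
        Real.Gamma ((N : ℝ) + M - l + α + 1) * (-t) ^ (N - l) := by
  rw [jacobi, show (N : ℝ) + ((M : ℝ) - N) + 1 = M + 1 by ring, Real.Gamma_nat_eq_factorial,
    show (N : ℝ) + ((M : ℝ) - N) + α + 1 = M + α + 1 by ring,
    ← Finset.sum_range_reflect (fun k : ℕ => (N.choose k : ℝ) *
      (Real.Gamma ((N : ℝ) + k + ((M : ℝ) - N) + α + 1) / Real.Gamma (k + ((M : ℝ) - N) + 1)) *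
        ((1 - 2 * t - 1) / 2) ^ k), Finset.mul_sum, Finset.mul_sum]
  refine Finset.sum_congr rfl fun l hl => ?_
  have hl' : l ≤ N := Nat.lt_succ_iff.1 (Finset.mem_range.1 hl)
  have e : N + 1 - 1 - l = N - l := by omega
  have e2 : ((N - l : ℕ) : ℝ) + ((M : ℝ) - N) + 1 = ((M - l : ℕ) : ℝ) + 1 := by
    rw [Nat.cast_sub hl', Nat.cast_sub (hl'.trans h)]; ring
  have e3 : (N : ℝ) + ((N - l : ℕ) : ℝ) + ((M : ℝ) - N) + α + 1 = (N : ℝ) + M - l + α + 1 := by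
    rw [Nat.cast_sub hl']; ring
  have e4 : (M.factorial : ℝ) = (M - l).factorial * M.descFactorial l := by
    exact_mod_cast (Nat.factorial_mul_descFactorial (hl'.trans h)).symm
  rw [e, e2, e3, Real.Gamma_nat_eq_factorial, Nat.choose_symm hl', e4,
    show (1 - 2 * t - 1) / 2 = -t by ring]
  have : ((M - l).factorial : ℝ) ≠ 0 := by positivity
  field_simp

/-- A form symmetric in `n` and `m`, without case distinction in the prefactor. At `t = 0` with `min
n m > 0` the power `(-t)^(-min n m)` takes the default value `0`, so that case is excluded. -/
lemma zernike_eq {α : ℝ} (hα : 0 < α) (n m : ℕ) {t : ℝ} (ht : t ≠ 0 ∨ min n m = 0) :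
    zernike n m α t =
      Real.sqrt (n.factorial * m.factorial / (Real.Gamma (n + α + 1) * Real.Gamma (m + α + 1))) /
        (n.factorial * m.factorial) *
      ∑ l ∈ Finset.range (min n m + 1), (n.choose l : ℝ) * m.descFactorial l *
        Real.Gamma ((n : ℝ) + m - l + α + 1) * ((-t) ^ l)⁻¹ := by
  have key : ∀ N M : ℕ, N ≤ M → (t ≠ 0 ∨ N = 0) →
      Real.sqrt (Real.Gamma (M + α + 1) * N.factorial / (Real.Gamma (N + α + 1) * M.factorial)) *
      (-t) ^ (-(N : ℤ)) * jacobi N ((M : ℝ) - N) α (1 - 2 * t) =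
      Real.sqrt (N.factorial * M.factorial / (Real.Gamma (N + α + 1) * Real.Gamma (M + α + 1))) /
        (N.factorial * M.factorial) *
      ∑ l ∈ Finset.range (N + 1), (N.choose l : ℝ) * M.descFactorial l *
        Real.Gamma ((N : ℝ) + M - l + α + 1) * ((-t) ^ l)⁻¹ := by
    intro N M hNM htN
    have hN : 0 < Real.Gamma (N + α + 1) := Real.Gamma_pos_of_pos (by positivity)
    have hM : 0 < Real.Gamma (M + α + 1) := Real.Gamma_pos_of_pos (by positivity)
    have hs : Real.sqrt (Real.Gamma (M + α + 1) * N.factorial /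
        (Real.Gamma (N + α + 1) * M.factorial)) = Real.Gamma (M + α + 1) / M.factorial *
        Real.sqrt (N.factorial * M.factorial /
          (Real.Gamma (N + α + 1) * Real.Gamma (M + α + 1))) := by
      rw [← Real.sqrt_sq (show 0 ≤ Real.Gamma (M + α + 1) / M.factorial by positivity),
        ← Real.sqrt_mul (by positivity)]
      congr 1
      field_simp
    rw [jacobi_one_sub_two_mul hNM, hs, Finset.mul_sum, Finset.mul_sum, Finset.mul_sum]
    refine Finset.sum_congr rfl fun l hl => ?_
    have hl' : l ≤ N := Nat.lt_succ_iff.1 (Finset.mem_range.1 hl)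
    have hpow : (-t) ^ (-(N : ℤ)) * (-t) ^ (N - l) = ((-t) ^ l)⁻¹ := by
      rcases htN with h0 | rfl
      · have h0' : -t ≠ 0 := neg_ne_zero.2 h0
        rw [zpow_neg, zpow_natCast, pow_sub₀ _ h0' hl', ← mul_assoc,
          inv_mul_cancel₀ (pow_ne_zero _ h0'), one_mul]
      · obtain rfl : l = 0 := by omega
        simp
    rw [← hpow]
    field_simp
  rcases le_total n m with h | h
  · have := key n m h (by rwa [min_eq_left h] at ht)
    rw [zernike, max_eq_right h, min_eq_left h, abs_sub_comm, abs_of_nonneg (by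
      rw [sub_nonneg]; exact_mod_cast h), this]
  · have := key m n h (by rwa [min_eq_right h] at ht)
    rw [zernike, max_eq_left h, min_eq_right h, abs_of_nonneg (by
      rw [sub_nonneg]; exact_mod_cast h), this, mul_comm (m.factorial : ℝ),
      mul_comm (Real.Gamma (m + α + 1))]
    congr 1
    refine Finset.sum_congr rfl fun l _ => ?_
    rw [add_comm (m : ℝ)]
    congr 2
    exact_mod_cast choose_mul_descFactorial_comm m n l

/-- Both sides equal `|z - w|² / (z - w̄)²`, since conjugating `z - w̄` gives `-(w - z̄)`. -/
lemma affine_ratio_mul (z w : ℍ) :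
    (((z : ℂ) - w) / (z - conj (w : ℂ))) * ((conj (z : ℂ) - conj (w : ℂ)) / (z - conj (w : ℂ))) =
      ((-(‖((z : ℂ) - w) / (z - conj (w : ℂ))‖ ^ 2) : ℝ) : ℂ) *
        (((w : ℂ) - conj (z : ℂ)) / (z - conj (w : ℂ))) := by
  have h1 := coe_sub_conj_coe_ne_zero z w
  have h2 : conj (z : ℂ) - w ≠ 0 := by
    have := (map_ne_zero (starRingEnd ℂ)).2 h1
    simpa using this
  rw [Complex.ofReal_neg, Complex.ofReal_pow, ← Complex.mul_conj', map_div₀, map_sub, map_sub,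
    Complex.conj_conj]
  field_simp
  ring

/-- For equal indices the first two ratios carry the same exponent `n - l`, so `affine_ratio_mul`
applies without division and `z = w` needs no exception. -/
lemma reproducingKernel_psi {α : ℝ} (hα : 0 < α) (n : ℕ) (z w : ℍ) :
    reproducingKernel (psi α hα n) z w =
      ((α / (4 * Real.pi) : ℝ) : ℂ) *
        (((w : ℂ) - conj (z : ℂ)) / ((z : ℂ) - conj (w : ℂ))) ^ n *
        (2 * (Real.sqrt (z.im * w.im) : ℂ) /
          (Complex.I * (conj (w : ℂ) - (z : ℂ)))) ^ ((α : ℂ) + 1) *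
        (jacobi n 0 α (1 - 2 * ‖((z : ℂ) - (w : ℂ)) / ((z : ℂ) - conj (w : ℂ))‖ ^ 2) : ℂ) := by
  have hΓ : 0 < Real.Gamma (n + α + 1) := Real.Gamma_pos_of_pos (by positivity)
  have hab := affine_ratio_mul z w
  have hJ := jacobi_one_sub_two_mul (α := α) (le_refl n)
    (‖((z : ℂ) - (w : ℂ)) / ((z : ℂ) - conj (w : ℂ))‖ ^ 2)
  rw [sub_self] at hJ
  rw [reproducingKernel, admissibilityConst_psi, ENNReal.toReal_ofReal (by positivity), inv_div,
    inner_affineRep_psi hα, hJ, min_self]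
  generalize ‖((z : ℂ) - (w : ℂ)) / ((z : ℂ) - conj (w : ℂ))‖ ^ 2 = t at *
  generalize ((z : ℂ) - (w : ℂ)) / ((z : ℂ) - conj (w : ℂ)) = a at *
  generalize (conj (z : ℂ) - conj (w : ℂ)) / ((z : ℂ) - conj (w : ℂ)) = b at *
  generalize ((w : ℂ) - conj (z : ℂ)) / ((z : ℂ) - conj (w : ℂ)) = ω at *
  generalize (2 * (Real.sqrt (z.im * w.im) : ℂ) /
          (Complex.I * (conj (w : ℂ) - (z : ℂ)))) ^ ((α : ℂ) + 1) = q
  have hs : Real.sqrt (n.factorial * n.factorial / (Real.Gamma (n + α + 1) *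
      Real.Gamma (n + α + 1))) / (n.factorial * n.factorial) =
      1 / (n.factorial * Real.Gamma (n + α + 1)) := by
    rw [mul_div_mul_comm, Real.sqrt_mul_self (by positivity)]
    field_simp
  have hsum : ∑ l ∈ Finset.range (n + 1),
        ((n.choose l * n.descFactorial l * Real.Gamma ((n : ℝ) + n - l + α + 1) : ℝ) : ℂ) *
        (a ^ (n - l) * b ^ (n - l) * ω ^ l) =
      ω ^ n * ((∑ l ∈ Finset.range (n + 1), (n.choose l : ℝ) * n.descFactorial l *
        Real.Gamma ((n : ℝ) + n - l + α + 1) * (-t) ^ (n - l) : ℝ) : ℂ) := by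
    rw [Complex.ofReal_sum, Finset.mul_sum]
    refine Finset.sum_congr rfl fun l hl => ?_
    have hl' : l ≤ n := Nat.lt_succ_iff.1 (Finset.mem_range.1 hl)
    rw [← mul_pow, hab, mul_pow, ← Complex.ofReal_pow, Complex.ofReal_mul (_ * _ * _),
      ← pow_sub_mul_pow ω hl']
    ring
  rw [hs, hsum, Complex.ofReal_mul (1 / _)]
  ring

/-! ### The wavelet transform and its behaviour at `i`. -/

lemma affineRep_I (ψ : L2R) : affineRep UpperHalfPlane.I ψ = ψ := by
  refine Lp.ext ?_
  have h : affineRep UpperHalfPlane.I ψ =ᵐ[volume] fun t =>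
      (((Real.sqrt UpperHalfPlane.I.im)⁻¹ : ℝ) : ℂ) *
        ψ (UpperHalfPlane.I.im⁻¹ * (t - UpperHalfPlane.I.re)) := MemLp.coeFn_toLp _
  filter_upwards [h] with t ht
  rw [ht]
  simp

lemma waveletTransform_psi {α : ℝ} (hα : 0 < α) (n m : ℕ) (z : ℍ) :
    waveletTransform (psi α hα n) (psi α hα m) z =
      ((Real.sqrt (n.factorial * m.factorial / (Real.Gamma (n + α + 1) * Real.Gamma (m + α + 1))) /
        (n.factorial * m.factorial) : ℝ) : ℂ) *
      (2 * (Real.sqrt z.im : ℂ) / (1 - Complex.I * z)) ^ ((α : ℂ) + 1) *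
      ∑ l ∈ Finset.range (min n m + 1),
        ((n.choose l * m.descFactorial l * Real.Gamma ((n : ℝ) + m - l + α + 1) : ℝ) : ℂ) *
        ((((z : ℂ) - Complex.I) / (z + Complex.I)) ^ (m - l) *
          ((conj (z : ℂ) + Complex.I) / (z + Complex.I)) ^ (n - l) *
          ((Complex.I - conj (z : ℂ)) / (z + Complex.I)) ^ l) := by
  have h := inner_affineRep_psi hα n m z UpperHalfPlane.I
  have hp : Complex.I * (-Complex.I - (z : ℂ)) = 1 - Complex.I * z := by
    rw [mul_sub, mul_neg, Complex.I_mul_I, neg_neg]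
  rw [affineRep_I] at h
  simp only [UpperHalfPlane.I_im, mul_one, UpperHalfPlane.coe_I, Complex.conj_I, hp,
    sub_neg_eq_add] at h
  exact h

lemma waveletTransform_eq_waveletFormula {α : ℝ} (hα : 0 < α) (n m : ℕ) (z : ℍ)
    (hz : z ≠ UpperHalfPlane.I ∨ min n m = 0) :
    waveletTransform (psi α hα n) (psi α hα m) z = waveletFormula α n m z := by
  have hne : (z : ℂ) + Complex.I ≠ 0 := by
    have := coe_sub_conj_coe_ne_zero z UpperHalfPlane.I
    simpa using this
  have ht : ‖((z : ℂ) - Complex.I) / (z + Complex.I)‖ ^ 2 ≠ 0 ∨ min n m = 0 := by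
    refine hz.imp_left fun h => ?_
    refine pow_ne_zero _ (norm_ne_zero_iff.2 (div_ne_zero (sub_ne_zero.2 fun h2 => h ?_) hne))
    exact UpperHalfPlane.ext (by simpa using h2)
  have hab := affine_ratio_mul z UpperHalfPlane.I
  simp only [UpperHalfPlane.coe_I, Complex.conj_I, sub_neg_eq_add] at hab
  rw [waveletTransform_psi, waveletFormula, zernike_eq hα n m ht]
  generalize ‖((z : ℂ) - Complex.I) / (z + Complex.I)‖ ^ 2 = t at *
  generalize ((z : ℂ) - Complex.I) / (z + Complex.I) = a at *
  generalize (conj (z : ℂ) + Complex.I) / (z + Complex.I) = b at *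
  generalize (Complex.I - conj (z : ℂ)) / (z + Complex.I) = ω at *
  generalize (2 * (Real.sqrt z.im : ℂ) / (1 - Complex.I * z)) ^ ((α : ℂ) + 1) = q
  have hsum : ∑ l ∈ Finset.range (min n m + 1),
        ((n.choose l * m.descFactorial l * Real.Gamma ((n : ℝ) + m - l + α + 1) : ℝ) : ℂ) *
        (a ^ (m - l) * b ^ (n - l) * ω ^ l) =
      a ^ m * b ^ n * ((∑ l ∈ Finset.range (min n m + 1), (n.choose l : ℝ) * m.descFactorial l *
        Real.Gamma ((n : ℝ) + m - l + α + 1) * ((-t) ^ l)⁻¹ : ℝ) : ℂ) := by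
    rw [Complex.ofReal_sum, Finset.mul_sum]
    refine Finset.sum_congr rfl fun l hl => ?_
    have hl' := Finset.mem_range.1 hl
    -- Solving `ab = -tω` for `ω` needs `t ≠ 0`, that is `z ≠ i`; if `min n m = 0`, only `l = 0`
    -- occurs.
    have hω : ω ^ l = a ^ l * b ^ l * ((((-t) ^ l)⁻¹ : ℝ) : ℂ) := by
      rcases ht with h0 | h0
      · have h0' : ((-t : ℝ) : ℂ) ≠ 0 := Complex.ofReal_ne_zero.2 (neg_ne_zero.2 h0)
        rw [← mul_pow, hab, mul_pow, Complex.ofReal_inv, Complex.ofReal_pow, mul_right_comm,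
          mul_inv_cancel₀ (pow_ne_zero _ h0'), one_mul]
      · obtain rfl : l = 0 := by omega
        simp
    rw [hω, Complex.ofReal_mul (_ * _ * _), ← pow_sub_mul_pow a (by omega : l ≤ m),
      ← pow_sub_mul_pow b (by omega : l ≤ n)]
    ring
  rw [hsum, Complex.ofReal_mul (_ / _)]
  ring

lemma continuousAt_waveletTransform_psi {α : ℝ} (hα : 0 < α) (n m : ℕ) :
    ContinuousAt (waveletTransform (psi α hα n) (psi α hα m)) UpperHalfPlane.I := by
  rw [show waveletTransform (psi α hα n) (psi α hα m) = _ from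
    funext (waveletTransform_psi hα n m)]
  have hI : (UpperHalfPlane.I : ℂ) + Complex.I ≠ 0 := by
    rw [UpperHalfPlane.coe_I, ← two_mul]
    exact mul_ne_zero two_ne_zero Complex.I_ne_zero
  have hcoe : Continuous (fun z : ℍ => (z : ℂ)) := UpperHalfPlane.continuous_coe
  have him : Continuous (fun z : ℍ => (Real.sqrt z.im : ℂ)) :=
    Complex.continuous_ofReal.comp (Real.continuous_sqrt.comp UpperHalfPlane.continuous_im)
  have hconj : Continuous (fun z : ℍ => conj (z : ℂ)) := Complex.continuous_conj.comp hcoe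
  have hden : 1 - Complex.I * (UpperHalfPlane.I : ℂ) = 2 := by
    rw [UpperHalfPlane.coe_I, Complex.I_mul_I]; norm_num
  refine ContinuousAt.mul (ContinuousAt.mul continuousAt_const ?_) ?_
  -- At `z = i` the base of the complex power is `1`, away from the branch cut.
  · refine ContinuousAt.cpow ?_ continuousAt_const ?_
    · exact (continuousAt_const.mul him.continuousAt).div
        (continuousAt_const.sub (continuousAt_const.mul hcoe.continuousAt)) (by
          rw [hden]; exact two_ne_zero)
    · rw [hden]
      simp
  · refine tendsto_finsetSum _ fun l _ => ?_
    have hadd : ContinuousAt (fun z : ℍ => (z : ℂ) + Complex.I) UpperHalfPlane.I :=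
      hcoe.continuousAt.add continuousAt_const
    exact continuousAt_const.mul
      (((((hcoe.continuousAt.sub continuousAt_const).div hadd hI).pow _).mul
        (((hconj.continuousAt.add continuousAt_const).div hadd hI).pow _)).mul
        (((continuousAt_const.sub hconj.continuousAt).div hadd hI).pow _))

end AnalyticWavelet

theorem mainTheorem4 (α : ℝ) (hα : 0 < α) :
    (∀ n : ℕ, AnalyticWavelet.admissibilityConst (AnalyticWavelet.psi α hα n) =
      ENNReal.ofReal (4 * Real.pi / α)) ∧
    (∀ (n : ℕ) (z w : ℍ), AnalyticWavelet.reproducingKernel (AnalyticWavelet.psi α hα n) z w =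
      ((α / (4 * Real.pi) : ℝ) : ℂ) *
        (((w : ℂ) - conj (z : ℂ)) / ((z : ℂ) - conj (w : ℂ))) ^ n *
        (2 * (Real.sqrt (z.im * w.im) : ℂ) /
          (Complex.I * (conj (w : ℂ) - (z : ℂ)))) ^ ((α : ℂ) + 1) *
        (AnalyticWavelet.jacobi n 0 α
          (1 - 2 * ‖((z : ℂ) - (w : ℂ)) / ((z : ℂ) - conj (w : ℂ))‖ ^ 2) : ℂ)) ∧
    (∀ n m : ℕ,
      (∀ z : ℍ, z ≠ UpperHalfPlane.I ∨ min n m = 0 →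
        AnalyticWavelet.waveletTransform (AnalyticWavelet.psi α hα n)
            (AnalyticWavelet.psi α hα m) z =
          AnalyticWavelet.waveletFormula α n m z) ∧
      Tendsto (AnalyticWavelet.waveletFormula α n m) (𝓝[≠] UpperHalfPlane.I)
        (𝓝 (AnalyticWavelet.waveletTransform (AnalyticWavelet.psi α hα n)
          (AnalyticWavelet.psi α hα m) UpperHalfPlane.I))) := by
  refine ⟨AnalyticWavelet.admissibilityConst_psi hα, AnalyticWavelet.reproducingKernel_psi hα,
    fun n m => ⟨AnalyticWavelet.waveletTransform_eq_waveletFormula hα n m, ?_⟩⟩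
  -- The transform is continuous at `i` and agrees with the formula off `i`, so the limit of the
  -- formula is the value of the transform.
  refine ((AnalyticWavelet.continuousAt_waveletTransform_psi hα n m).tendsto.mono_left
    nhdsWithin_le_nhds).congr' ?_
  filter_upwards [self_mem_nhdsWithin] with z hz
  exact AnalyticWavelet.waveletTransform_eq_waveletFormula hα n m z (Or.inl hz)
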